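/- Manifolds are smooth, Hausdorff and second countable (not necessarily connected), all maps and tensors are smooth, $n\ge 0$, and $\mathbb T^n=(\mathbb R/2\pi\mathbb Z)^n$, with Lie algebra $\mathbb R^n$, whose dual is identified with $\mathbb R^n$. Definitions. Let $(M,\sigma)$ be an almost-symplectic manifold of dimension $2n$, that is, $\sigma$ is a non-degenerate, not necessarily closed, 2-form on $M$. For $f\in C^\infty(M)$ let $X_f$ be the vector field with $i_{X_f}\sigma=-df$. A vector field $X$ is fully-Hamiltonian if $X=X_f$ for some $f\in C^\infty(M)$ and $L_X\sigma=0$; in this case $f$ is called fully-Hamiltonian. An action $\Psi$ of $\mathbb T^n$ on $M$ is fully-Hamiltonian if its infinitesimal generators $Y_\xi=\frac{d}{dt}\Psi_{\exp(t\xi)}|_{t=0}$, $\xi\in\mathbb R^n$, are all fully-Hamiltonian. A momentum map of $\Psi$ is a map $J:M\to\mathbb R^n$ with $d\big(\sum_i\xi_iJ_i\big)=-i_{Y_\xi}\sigma$ for all $\xi\in\mathbb R^n$. A fully-Lagrangian toric fibration of $(M,\sigma)$ is a smooth locally trivial fibration $\pi:M\to B$ over a manifold $B$ with compact, connected, non-empty,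 Lagrangian fibers such that $g\circ\pi$ is fully-Hamiltonian for every $g\in C^\infty(B)$. An action-angle chart of $\pi$ is a diffeomorphism $(a,\alpha):V\to\mathcal A\times\mathbb T^n$ from an open union $V$ of fibers of $\pi$, with $\mathcal A\subseteq\mathbb R^n$ open, such that the fibers of $\pi$ in $V$ are the sets $a=\mathrm{const}$ and $\sigma$ has the local representative $\sum_i da_i\wedge d\alpha_i+\frac12\sum_{i,j}A_{ij}(a)\,da_i\wedge da_j$, with $A(a)$ a skew-symmetric matrix depending smoothly on $a$. An atlas with global actions of $\pi$ is a set $\mathcal P$ of action-angle charts of $\pi$ whose domains cover $M$, such that $a=a'$ on $V\cap V'$ for any two charts $(a,\alpha):V\to\mathcal A\times\mathbb T^n$, $(a',\alpha'):V'\to\mathcal A'\times\mathbb T^n$ in $\mathcal P$, and such that the global action map $\hat a^{\mathcal P}:M\to\mathbb R^n$, which equals $a$ on the domain of each chart $(a,\alpha)$ in $\mathcal P$, has connected fibers. The fibration $\pi$ has global actions if it has such an atlas. Proposition. Let $(M,\sigma)$ be an almost-symplectic manifold of dimension $2n$. (i) Let $\pi:M\to B$ be a fully-Lagrangian toric fibration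 with global actions, and let $\mathcal P$ be any atlas with global actions of $\pi$. Then $\hat a^{\mathcal P}$ is the momentum map of a free fully-Hamiltonian action $\Psi$ of $\mathbb T^n$ on $M$ which in every chart $(a,\alpha)$ of $\mathcal P$ is the translation of the angles: $\Psi_\beta(a,\alpha)=(a,\alpha+\beta)$ for all $\beta\in\mathbb T^n$. (ii) Conversely, let $\Psi$ be a free fully-Hamiltonian action of $\mathbb T^n$ on $M$ which has a momentum map $J:M\to\mathbb R^n$ with connected fibers. Then $J(M)$ is open in $\mathbb R^n$, and $J:M\to J(M)$ is a fully-Lagrangian toric fibration with global actions; moreover it has an atlas with global actions whose global action map is $J$. In the charts of any atlas $\mathcal P$ with global actions of this fibration $\Psi$ acts by translation of the angles: there is a locally constant map $Z:M\to GL(n,\mathbb Z)$ such that in every chart $(a,\alpha)$ of $\mathcal P$ the domain is $\Psi$-invariant and $\Psi_\beta$ maps the point $m$ with coordinates $(a,\alpha)$ to the point with coordinates $(a,\alpha+Z(m)\beta)$, for all $\beta\in\mathbb T^n$. If $\hat a^{\mathcal P}=J$, then $\Psi_\beta(a,\alpha)=(a,\alpha+\beta)$ in every chart of $\mathcal P$.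 -/

import Mathlib

open Set Topology
open scoped Manifold ContDiff

universe u v

namespace AlmostSymplectic

/-- `ℝⁿ`. -/
abbrev E (n : ℕ) : Type := EuclideanSpace ℝ (Fin n)

/-- The torus `𝕋ⁿ = (ℝ / 2πℤ)ⁿ`, written multiplicatively as a product of unit circles; the angle
`α` mod `2π` corresponds to `exp (iα)`, so adding angles is multiplication. -/
abbrev Torus (n : ℕ) : Type := Fin n → Circle

/-- The covering map `ℝⁿ → 𝕋ⁿ`, reduction of angles modulo `2π`. It is also the exponential map of
the Lie group `𝕋ⁿ`, whose Lie algebra is `ℝⁿ`. -/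
noncomputable def torusExp {n : ℕ} (t : E n) : Torus n := fun i => Circle.exp (t i)

section Forms

variable {n : ℕ} {M : Type u} [TopologicalSpace M] [ChartedSpace (E (2 * n)) M]
  [IsManifold (𝓡 (2 * n)) ∞ M]

/-- A smooth non-degenerate (not necessarily closed) 2-form on the `2n`-dimensional manifold `M`. -/
structure Form (n : ℕ) (M : Type u) [TopologicalSpace M] [ChartedSpace (E (2 * n)) M]
    [IsManifold (𝓡 (2 * n)) ∞ M] where
  /-- the value of the form at a point -/
  val : ∀ x : M, TangentSpace (𝓡 (2 * n)) x →L[ℝ] TangentSpace (𝓡 (2 * n)) x →L[ℝ] ℝ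
  alternating : ∀ x v, val x v v = 0
  nondegenerate : ∀ x v, (∀ w, val x v w = 0) → v = 0
  smooth : ContMDiff (𝓡 (2 * n)) ((𝓡 (2 * n)).prod 𝓘(ℝ, E (2 * n) →L[ℝ] E (2 * n) →L[ℝ] ℝ)) ∞
    (fun x => (⟨x, val x⟩ : Bundle.TotalSpace (E (2 * n) →L[ℝ] E (2 * n) →L[ℝ] ℝ)
      (fun x : M => TangentSpace (𝓡 (2 * n)) x →L[ℝ] TangentSpace (𝓡 (2 * n)) x →L[ℝ] ℝ)))

/-- Vector fields on `M` (not necessarily smooth). -/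
abbrev VField (n : ℕ) (M : Type u) [TopologicalSpace M] [ChartedSpace (E (2 * n)) M] : Type u :=
  ∀ x : M, TangentSpace (𝓡 (2 * n)) x

/-- The vector field `X` is smooth at (and hence, for every finite order, near) the point `m`. -/
def SmoothFieldAt (X : VField n M) (m : M) : Prop :=
  ContMDiffAt (𝓡 (2 * n)) (𝓡 (2 * n)).tangent ∞
    (fun x => (⟨x, X x⟩ : TangentBundle (𝓡 (2 * n)) M)) m

/-- Smooth vector fields. -/
def SmoothField (X : VField n M) : Prop := ∀ m, SmoothFieldAt X m

/-- The derivative `df` at `m` of a real function on `M`. -/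
noncomputable def dAt (f : M → ℝ) (m : M) : TangentSpace (𝓡 (2 * n)) m →L[ℝ] ℝ :=
  mfderiv (𝓡 (2 * n)) 𝓘(ℝ, ℝ) f m

/-- The Lie derivative `(L_X σ)(Y, Z) = X (σ(Y, Z)) - σ([X, Y], Z) - σ(Y, [X, Z])` at `m`. -/
noncomputable def lieDeriv (σ : Form n M) (X Y Z : VField n M) (m : M) : ℝ :=
  dAt (fun x => σ.val x (Y x) (Z x)) m (X m)
    - σ.val m (VectorField.mlieBracket (𝓡 (2 * n)) X Y m) (Z m)
    - σ.val m (Y m) (VectorField.mlieBracket (𝓡 (2 * n)) X Z m)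

/-- `X` is a symmetry of `σ`, that is `L_X σ = 0`. -/
def IsSymmetry (σ : Form n M) (X : VField n M) : Prop :=
  ∀ (m : M) (Y Z : VField n M), SmoothFieldAt Y m → SmoothFieldAt Z m → lieDeriv σ X Y Z m = 0

/-- `f` is a Hamiltonian of `X`: `i_X σ = -df`, that is `X = X_f^σ`. -/
def IsHamiltonianOf (σ : Form n M) (f : M → ℝ) (X : VField n M) : Prop :=
  ∀ (m : M) (v : TangentSpace (𝓡 (2 * n)) m), σ.val m (X m) v = - dAt f m v

/-- Partially-Hamiltonian vector fields: `i_X σ` is exact. -/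
def PartiallyHamiltonian (σ : Form n M) (X : VField n M) : Prop :=
  SmoothField X ∧
    ∃ f : M → ℝ, ContMDiff (𝓡 (2 * n)) 𝓘(ℝ, ℝ) ∞ f ∧ IsHamiltonianOf σ f X

/-- Fully-Hamiltonian vector fields: partially-Hamiltonian symmetries of `σ`. -/
def FullyHamiltonian (σ : Form n M) (X : VField n M) : Prop :=
  PartiallyHamiltonian σ X ∧ IsSymmetry σ X

/-- Fully-Hamiltonian functions: smooth functions `f` such that `X_f^σ` is fully-Hamiltonian. -/
def FullyHamiltonianFunction (σ : Form n M) (f : M → ℝ) : Prop :=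
  ContMDiff (𝓡 (2 * n)) 𝓘(ℝ, ℝ) ∞ f ∧
    ∃ X : VField n M, IsHamiltonianOf σ f X ∧ FullyHamiltonian σ X

/-- A subspace `W` of the tangent space at `m` is Lagrangian: `σ` vanishes on it and its dimension
is half of that of `M`. -/
def IsLagrangianSubspace (σ : Form n M) (m : M)
    (W : Submodule ℝ (TangentSpace (𝓡 (2 * n)) m)) : Prop :=
  (∀ v ∈ W, ∀ w ∈ W, σ.val m v w = 0) ∧ Module.finrank ℝ W = n

end Forms

section Fibrations

variable {n k : ℕ} {M : Type u} [TopologicalSpace M] [ChartedSpace (E (2 * n)) M]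
  {B : Type v} [TopologicalSpace B] [ChartedSpace (E k) B]

/-- Smooth locally trivial fibrations: over a neighbourhood `U` of each point of the base there is
a diffeomorphism of `π⁻¹(U)` onto `U × F`, for some manifold `F`, which is compatible with the
projections onto `U`. -/
def IsSmoothFibration (π : M → B) : Prop :=
  ContMDiff (𝓡 (2 * n)) (𝓡 k) ∞ π ∧
  ∀ b : B, ∃ U : Set B, IsOpen U ∧ b ∈ U ∧
    ∃ (V : Type) (_ : NormedAddCommGroup V) (_ : NormedSpace ℝ V) (_ : FiniteDimensional ℝ V)
      (F : Type) (_ : TopologicalSpace F) (_ : ChartedSpace V F) (_ : IsManifold 𝓘(ℝ, V) ∞ F)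
      (Φ : PartialDiffeomorph (𝓡 (2 * n)) ((𝓡 k).prod 𝓘(ℝ, V)) M (B × F) ∞),
      Φ.source = π ⁻¹' U ∧ Φ.target = U ×ˢ univ ∧ ∀ m ∈ Φ.source, (Φ m).1 = π m

/-- Fully-Lagrangian toric fibrations: fibrations with compact, connected (in particular
non-empty), Lagrangian fibers, all of whose basic functions are fully-Hamiltonian. The tangent
space at `m` of the fiber through `m` is the kernel of the derivative of `π` at `m`. -/
structure IsFullyLagrangianToricFibration [IsManifold (𝓡 (2 * n)) ∞ M]
    (σ : Form n M) (π : M → B) : Prop where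
  fibration : IsSmoothFibration (n := n) (k := k) π
  compact_fibers : ∀ b, IsCompact (π ⁻¹' {b})
  connected_fibers : ∀ b, IsConnected (π ⁻¹' {b})
  lagrangian_fibers : ∀ m : M,
    IsLagrangianSubspace σ m (mfderiv (𝓡 (2 * n)) (𝓡 k) π m).ker
  basic_functions : ∀ g : B → ℝ, ContMDiff (𝓡 k) 𝓘(ℝ, ℝ) ∞ g →
    FullyHamiltonianFunction σ (g ∘ π)

end Fibrations

section Charts

/-- A diffeomorphism `(a, α)` of an open set `V = source` of `M` onto `𝒜 × 𝕋ⁿ`, where `𝒜` is an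
open set of `ℝⁿ`. Smoothness of the inverse is expressed after composition with the covering
(a local diffeomorphism) `𝒜 × ℝⁿ → 𝒜 × 𝕋ⁿ`. -/
structure ToricChart (n : ℕ) (M : Type u) [TopologicalSpace M] [ChartedSpace (E (2 * n)) M]
    extends PartialEquiv M (E n × Torus n) where
  /-- the set `𝒜` of the values of the actions -/
  actionSet : Set (E n)
  isOpen_source : IsOpen source
  isOpen_actionSet : IsOpen actionSet
  target_eq : target = actionSet ×ˢ univ
  smooth_action : ContMDiffOn (𝓡 (2 * n)) (𝓡 n) ∞ (fun m => (toFun m).1) source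
  smooth_angle : ∀ i, ContMDiffOn (𝓡 (2 * n)) (𝓡 1) ∞ (fun m => (toFun m).2 i) source
  smooth_symm : ContMDiffOn 𝓘(ℝ, E n × E n) (𝓡 (2 * n)) ∞
    (fun p : E n × E n => invFun (p.1, torusExp p.2)) (actionSet ×ˢ univ)

variable {n k : ℕ} {M : Type u} [TopologicalSpace M] [ChartedSpace (E (2 * n)) M]

/-- The action coordinates `a` of a chart. -/
def ToricChart.action (c : ToricChart n M) (m : M) : E n := (c.toFun m).1

/-- The angle coordinates `α` of a chart. -/
def ToricChart.angle (c : ToricChart n M) (m : M) : Torus n := (c.toFun m).2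

/-- The inverse of a chart, lifted to `𝒜 × ℝⁿ`. -/
noncomputable def ToricChart.param (c : ToricChart n M) (p : E n × E n) : M :=
  c.invFun (p.1, torusExp p.2)

/-- The 2-form `∑ᵢ daᵢ ∧ dαᵢ + ½ ∑ᵢⱼ Aᵢⱼ daᵢ ∧ daⱼ` on `ℝⁿ × ℝⁿ ∋ (a, α)`, at a point where the
coefficients have the value `A`. -/
noncomputable def modelForm (A : Matrix (Fin n) (Fin n) ℝ) (u v : E n × E n) : ℝ :=
  ∑ i, (u.1 i * v.2 i - v.1 i * u.2 i)
    + 1 / 2 * ∑ i, ∑ j, A i j * (u.1 i * v.1 j - v.1 i * u.1 j)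

variable [IsManifold (𝓡 (2 * n)) ∞ M] {B : Type v}

/-- `c = (a, α)` is a system of action-angle coordinates of the fibration `π`: its domain is a union
of fibers of `π`, on it the fibers of `π` are the sets `a = const`, and the local
representative of `σ` is `∑ᵢ daᵢ ∧ dαᵢ + ½ ∑ᵢⱼ Aᵢⱼ(a) daᵢ ∧ daⱼ` with `A` skew-symmetric and
smooth. -/
structure IsActionAngleChart (σ : Form n M) (π : M → B) (c : ToricChart n M) : Prop where
  fibers : ∀ m ∈ c.source, ∀ m' : M, π m' = π m ↔ m' ∈ c.source ∧ c.action m' = c.action m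
  form : ∃ A : E n → Matrix (Fin n) (Fin n) ℝ,
    (∀ i j, ContDiffOn ℝ ∞ (fun a => A a i j) c.actionSet) ∧
    (∀ a ∈ c.actionSet, (A a).transpose = - A a) ∧
    ∀ a ∈ c.actionSet, ∀ t : E n, ∀ u v : E n × E n,
      σ.val (c.param (a, t))
        (mfderiv 𝓘(ℝ, E n × E n) (𝓡 (2 * n)) c.param (a, t) u)
        (mfderiv 𝓘(ℝ, E n × E n) (𝓡 (2 * n)) c.param (a, t) v) = modelForm (A a) u v

open Classical in
/-- The map whose value at `m` is the value at `m` of the action coordinates of a chart of `P` whose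
domain contains `m`. -/
noncomputable def globalActionMap (P : Set (ToricChart n M)) (m : M) : E n :=
  if h : ∃ c ∈ P, m ∈ c.source then h.choose.action m else 0

/-- `P` is an action-angle atlas with global actions of the fibration `π`. -/
structure IsAtlasWithGlobalActions (σ : Form n M) (π : M → B) (P : Set (ToricChart n M)) :
    Prop where
  actionAngle : ∀ c ∈ P, IsActionAngleChart σ π c
  cover : ∀ m : M, ∃ c ∈ P, m ∈ c.source
  same_actions : ∀ c ∈ P, ∀ c' ∈ P, ∀ m ∈ c.source, m ∈ c'.source → c.action m = c'.action m
  connected_fibers : ∀ a : E n, IsPreconnected (globalActionMap P ⁻¹' {a})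

/-- In an atlas with global actions, any chart around `m` computes the global action map. -/
theorem IsAtlasWithGlobalActions.globalActionMap_eq {σ : Form n M} {π : M → B}
    {P : Set (ToricChart n M)} (hP : IsAtlasWithGlobalActions σ π P) {c : ToricChart n M}
    (hc : c ∈ P) {m : M} (hm : m ∈ c.source) : globalActionMap P m = c.action m := by
  have h : ∃ c ∈ P, m ∈ c.source := ⟨c, hc, hm⟩
  rw [globalActionMap, dif_pos h]
  exact hP.same_actions _ h.choose_spec.1 _ hc m h.choose_spec.2 hm

/-- The fibration `π` has global actions. -/
def HasGlobalActions (σ : Form n M) (π : M → B) : Prop :=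
  ∃ P : Set (ToricChart n M), IsAtlasWithGlobalActions σ π P

end Charts

section Actions

/-- A smooth action of `𝕋ⁿ` on `M`. Smoothness of `𝕋ⁿ × M → M` is expressed after composition with
the covering (a local diffeomorphism) `ℝⁿ × M → 𝕋ⁿ × M`. -/
structure TorusAction (n : ℕ) (M : Type u) [TopologicalSpace M] [ChartedSpace (E (2 * n)) M] where
  /-- the diffeomorphism of `M` given by an element of `𝕋ⁿ` -/
  act : Torus n → M → M
  act_one : ∀ m, act 1 m = m
  act_mul : ∀ β γ m, act (β * γ) m = act β (act γ m)
  smooth : ContMDiff ((𝓡 n).prod (𝓡 (2 * n))) (𝓡 (2 * n)) ∞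
    (fun p : E n × M => act (torusExp p.1) p.2)

variable {n : ℕ} {M : Type u} [TopologicalSpace M] [ChartedSpace (E (2 * n)) M]

namespace TorusAction

/-- The action is free. -/
def IsFree (Ψ : TorusAction n M) : Prop := ∀ (β : Torus n) (m : M), Ψ.act β m = m → β = 1

/-- The infinitesimal generator `Y_ξ(m) = d/dt Ψ_{exp(tξ)}(m)` at `t = 0`, for `ξ` in the Lie
algebra `ℝⁿ` of `𝕋ⁿ`. -/
noncomputable def generator (Ψ : TorusAction n M) (ξ : E n) : VField n M := fun m =>
  mfderiv 𝓘(ℝ, ℝ) (𝓡 (2 * n)) (fun t : ℝ => Ψ.act (torusExp (t • ξ)) m) 0 (1 : ℝ)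

variable [IsManifold (𝓡 (2 * n)) ∞ M]

/-- Fully-Hamiltonian actions: all infinitesimal generators are fully-Hamiltonian. -/
def IsFullyHamiltonian (Ψ : TorusAction n M) (σ : Form n M) : Prop :=
  ∀ ξ : E n, FullyHamiltonian σ (Ψ.generator ξ)

/-- `J` is a momentum map of the action: `dJ_ξ = -i_{Y_ξ} σ` for all `ξ`, where
`J_ξ = ⟨J, ξ⟩ = ∑ᵢ ξᵢ Jᵢ`. The dual of the Lie algebra `ℝⁿ` is identified with `ℝⁿ`. -/
def IsMomentumMap (Ψ : TorusAction n M) (σ : Form n M) (J : M → E n) : Prop :=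
  ContMDiff (𝓡 (2 * n)) (𝓡 n) ∞ J ∧
    ∀ ξ : E n, IsHamiltonianOf σ (fun m => ∑ i, ξ i * J m i) (Ψ.generator ξ)

/-- In the chart `(a, α)` the action is the translation of the angles
`Ψ_β (a, α) = (a, α + β)`. -/
def ActsByTranslation (Ψ : TorusAction n M) (c : ToricChart n M) : Prop :=
  ∀ m ∈ c.source, ∀ β : Torus n, Ψ.act β m ∈ c.source ∧
    c.action (Ψ.act β m) = c.action m ∧ c.angle (Ψ.act β m) = c.angle m * β

/-- In the chart `(a, α)` the action is the translation of the angles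
`Ψ_β (a, α) = (a, α + Z β)` by means of the automorphisms of `𝕋ⁿ` given by the integer unimodular
matrices `Z m`. -/
def ActsByTranslationVia (Ψ : TorusAction n M) (Z : M → GL (Fin n) ℤ) (c : ToricChart n M) :
    Prop :=
  ∀ m ∈ c.source, ∀ β : Torus n, Ψ.act β m ∈ c.source ∧
    c.action (Ψ.act β m) = c.action m ∧
    ∀ i, c.angle (Ψ.act β m) i = c.angle m i * ∏ j, β j ^ (Z m).val i j

end TorusAction

/-- A map `J : M → ℝⁿ` with open image, regarded as a map onto the manifold `J(M)`. -/
def ontoImage {n : ℕ} {M : Type u} (J : M → E n) (hJ : IsOpen (range J)) :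
    M → (⟨range J, hJ⟩ : TopologicalSpace.Opens (E n)) :=
  fun m => ⟨J m, mem_range_self m⟩

end Actions

end AlmostSymplectic

/-! The bridge between the two parts is that, in action-angle coordinates, the Hamiltonian vector
field of `⟨ξ, a⟩` is the constant field `ξ` in the angle directions (`hamiltonian_eq`). The terms
`A(a) da ∧ da` vanish when contracted with angle vectors, so the failure of `σ` to be closed is
invisible to these fields, and their integral curves are `(a, α + sξ)`.

(i) A component of the global action map is constant on the fibers of `π`. It therefore descends to
a smooth function on the base (`exists_basic_eq`) and is fully-Hamiltonian. In every chart its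
Hamiltonian flow translates the angles, so uniqueness of integral curves makes the translations of
different charts agree (`invFun_translate_eq`). They glue to a torus action, whose generators are
these Hamiltonian fields.

(ii) Everything rests on `σ(Y_ξ, v) = -⟨ξ, dJ v⟩`. A free action has an injective infinitesimal
action; by non-degeneracy `dJ` is then onto, and its kernel is the tangent space of the orbit. A
periodicity argument shows that `J` is invariant (`act_eq`). A local section `s` of `J` yields the
local diffeomorphism `(a, t) ↦ Ψ_{exp t}(s a)`, so orbits are open in the fibers of `J`, and
connected fibers are single orbits. This gives the charts. The coefficients of `σ` that involve an
angle are prescribed by the momentum map. The remaining ones do not depend on the angles, because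
`L_{Y_ξ} σ = 0` is evaluated on commuting coordinate fields (`pull_fst_eq`).

For a function `G` of the momentum map, `X_{G ∘ J} = ∑ ∂ᵢG(J) Yᵢ`. The formula `L_{fX} σ = f L_X σ +
df ∧ i_X σ` reduces `L_{X_{G ∘ J}} σ` to the antisymmetrized Hessian of `G`, which is zero.

For an arbitrary atlas `P`, part (i) supplies a reference action `Ψ'` that translates its angles.
Locally `J = h ∘ â`, so the generators of `Ψ` are those of `Ψ'` precomposed with `(Dh)ᵀ`, which is
constant along orbits. Since both actions are free, `(Dh)ᵀ` preserves periods in both directions and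
is an integer unimodular matrix. Being continuous as well, it is locally constant. -/

namespace AlmostSymplectic

/-! ### The covering of the torus: periods and local lifts -/

section Torus

variable {n : ℕ}

@[simp]
theorem torusExp_zero : torusExp (0 : E n) = 1 := by
  ext i; simp [torusExp]

theorem torusExp_add (s t : E n) : torusExp (s + t) = torusExp s * torusExp t := by
  funext i; simp [torusExp, Circle.exp_add]

theorem torusExp_surjective : Function.Surjective (torusExp : E n → Torus n) := fun β =>
  ⟨WithLp.toLp 2 fun i => ((β i : ℂ)).arg, by funext i; simp [torusExp]⟩

theorem torusExp_eq_one_iff {t : E n} :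
    torusExp t = 1 ↔ ∃ k : Fin n → ℤ, ∀ i, t i = k i * (2 * Real.pi) := by
  simp only [funext_iff, torusExp, Pi.one_apply, Circle.exp_eq_one]
  exact Classical.skolem

/-- The velocity of a trivial one-parameter subgroup of the torus vanishes. -/
theorem eq_zero_of_forall_torusExp_smul {t : E n} (h : ∀ s : ℝ, torusExp (s • t) = 1) :
    t = 0 := by
  ext i
  by_contra hi
  have hi' : t i ≠ 0 := hi
  -- At this time the `i`-th angle equals `π`, half a period.
  have := congrFun (h (Real.pi / t i)) i
  simp only [torusExp, PiLp.smul_apply, smul_eq_mul, Pi.one_apply,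
    div_mul_cancel₀ _ hi', Circle.exp_eq_one] at this
  obtain ⟨k, hk⟩ := this
  have h1 : (1 : ℝ) = k * 2 := by
    have := Real.pi_pos
    field_simp at hk
    linarith
  have h2 : (1 : ℤ) = k * 2 := by exact_mod_cast h1
  omega

variable {X : Type*} [NormedAddCommGroup X] [NormedSpace ℝ X] {H : Type*} [TopologicalSpace H]
  {I : ModelWithCorners ℝ X H} {N : Type*} [TopologicalSpace N] [ChartedSpace H N]

/-- Smooth maps to the circle lift locally through the exponential. -/
theorem exists_circle_lift {f : N → Circle} {x : N} (hf : ContMDiffAt I (𝓡 1) ∞ f x) (t : ℝ)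
    (ht : Circle.exp t = f x) :
    ∃ θ : N → ℝ, θ x = t ∧ ContMDiffAt I 𝓘(ℝ, ℝ) ∞ θ x ∧ ∀ y, Circle.exp (θ y) = f y := by
  have hcoe : ContMDiffAt I 𝓘(ℝ, ℂ) ∞ (fun y => (f y : ℂ)) x := by
    have := finrank_real_complex_fact'
    have : ContMDiff (𝓡 1) 𝓘(ℝ, ℂ) ∞ (fun z : Circle => (z : ℂ)) := contMDiff_coe_sphere
    exact this.contMDiffAt.comp x hf
  -- Dividing by `exp t` moves `f x` to `1`, away from the branch cut of `arg`. The lift identity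
  -- holds everywhere, smoothness only at `x`.
  refine ⟨fun y => t + ((f y / Circle.exp t : Circle) : ℂ).arg, ?_, ?_, ?_⟩
  · simp [ht]
  · have h1 : ContDiffAt ℝ ∞ (fun z : ℂ => t + (Complex.log (z / (Circle.exp t : ℂ))).im)
        (f x : ℂ) := by
      refine contDiffAt_const.add (Complex.imCLM.contDiff.contDiffAt.comp
        (f := fun z : ℂ => Complex.log (z / (Circle.exp t : ℂ))) _ ?_)
      refine ContDiffAt.comp (f := fun z : ℂ => z / (Circle.exp t : ℂ)) (g := Complex.log) _ ?_ ?_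
      · rw [ht]
        simp only [div_self (Circle.coe_ne_zero _)]
        exact (Complex.contDiffAt_log (n := ∞) (by simp)).restrict_scalars ℝ
      · exact contDiffAt_id.div_const _
    refine (ContDiffAt.comp_contMDiffAt (f := fun y => (f y : ℂ)) h1 hcoe).congr_of_eventuallyEq (.of_forall fun y => ?_)
    simp [Complex.log_im]
  · intro y
    rw [Circle.exp_add, Circle.exp_arg, mul_div_cancel]

/-- Smooth maps to the torus lift locally through the exponential. -/
theorem exists_torus_lift {f : N → Torus n} {x : N}
    (hf : ∀ i, ContMDiffAt I (𝓡 1) ∞ (fun y => f y i) x) (t : E n) (ht : torusExp t = f x) :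
    ∃ θ : N → E n, θ x = t ∧ ContMDiffAt I (𝓡 n) ∞ θ x ∧ ∀ y, torusExp (θ y) = f y := by
  choose θ h0 h1 h2 using fun i => exists_circle_lift (hf i) (t i) (congrFun ht i)
  refine ⟨fun y => WithLp.toLp 2 fun i => θ i y, ?_, ?_, ?_⟩
  · ext i; exact h0 i
  · have h3 : ContMDiffAt I 𝓘(ℝ, Fin n → ℝ) ∞ (fun y i => θ i y) x := contMDiffAt_pi_space.2 h1
    exact (EuclideanSpace.equiv (Fin n) ℝ).symm.contDiff.contMDiff.contMDiffAt.comp x h3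
  · intro y; funext i; exact h2 i y

theorem contMDiff_torusExp_apply (i : Fin n) :
    ContMDiff (𝓡 n) (𝓡 1) ∞ (fun t : E n => torusExp t i) :=
  contMDiff_circleExp.comp (contDiff_piLp_apply (p := 2) (i := i)).contMDiff

end Torus

/-! ### Inverse function theorem -/

section InverseFunction

variable {X : Type*} [NormedAddCommGroup X] [NormedSpace ℝ X] [FiniteDimensional ℝ X]
  {Y : Type*} [NormedAddCommGroup Y] [NormedSpace ℝ Y]
  {N : Type*} [TopologicalSpace N] [ChartedSpace Y N] [IsManifold 𝓘(ℝ, Y) ∞ N]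


/-- The local homeomorphism at `p` has a smooth inverse wherever the derivative is invertible; this
is an open condition, to which the source is restricted. -/
theorem exists_partialDiffeomorph_of_fderiv {f : X → Y} {s : Set X} (hs : IsOpen s)
    (hf : ContDiffOn ℝ ∞ f s) {p : X} (hp : p ∈ s) (f' : X ≃L[ℝ] Y)
    (hf' : fderiv ℝ f p = f') :
    ∃ Φ : PartialDiffeomorph 𝓘(ℝ, X) 𝓘(ℝ, Y) X Y ∞,
      p ∈ Φ.source ∧ Φ.source ⊆ s ∧ EqOn f Φ Φ.source := by
  have : CompleteSpace X := FiniteDimensional.complete ℝ X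
  have hat : ∀ x ∈ s, ContDiffAt ℝ ∞ f x := fun x hx => hf.contDiffAt (hs.mem_nhds hx)
  have hd : HasFDerivAt f (f' : X →L[ℝ] Y) p :=
    hf' ▸ ((hat p hp).differentiableAt (by simp)).hasFDerivAt
  set e := (hat p hp).toOpenPartialHomeomorph f hd (by simp) with he
  set u : Set X := s ∩ fderiv ℝ f ⁻¹' (range ((↑) : (X ≃L[ℝ] Y) → X →L[ℝ] Y)) with hu
  have huo : IsOpen u :=
    (hf.continuousOn_fderiv_of_isOpen hs (by simp)).isOpen_inter_preimage hs
      ContinuousLinearEquiv.isOpen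
  have hpu : p ∈ u := ⟨hp, f', hf'.symm⟩
  refine ⟨⟨(e.restr u).toPartialEquiv, (e.restr u).open_source, (e.restr u).open_target, ?_, ?_⟩,
    ?_, ?_, ?_⟩
  · refine contMDiffOn_iff_contDiffOn.2 (hf.mono fun x hx => ?_)
    have hx' : x ∈ (e.restr u).source := hx
    rw [e.restr_source' u huo] at hx'
    exact hx'.2.1
  · refine contMDiffOn_iff_contDiffOn.2 fun y hy => ContDiffAt.contDiffWithinAt ?_
    have hy' : y ∈ (e.restr u).target := hy
    have h1 : (e.restr u).symm y ∈ (e.restr u).source := (e.restr u).map_target hy'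
    rw [e.restr_source' u huo] at h1
    obtain ⟨h2, h3, g, hg⟩ := h1
    have h4 : y ∈ e.target := hy'.1
    refine e.contDiffAt_symm (f₀' := g) h4 ?_ (hat _ h3)
    rw [hg]
    exact ((hat _ h3).differentiableAt (by simp)).hasFDerivAt
  · show p ∈ (e.restr u).source
    rw [e.restr_source' u huo]
    exact ⟨(hat p hp).mem_toOpenPartialHomeomorph_source hd (by simp), hpu⟩
  · intro x hx
    have hx' : x ∈ (e.restr u).source := hx
    rw [e.restr_source' u huo] at hx'
    exact hx'.2.1
  · intro x _; rfl


theorem exists_partialDiffeomorph_chart (m : N) :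
    ∃ e : PartialDiffeomorph 𝓘(ℝ, Y) 𝓘(ℝ, Y) N Y ∞, m ∈ e.source :=
  ⟨⟨extChartAt 𝓘(ℝ, Y) m, isOpen_extChartAt_source m, isOpen_extChartAt_target m,
    by rw [extChartAt_source]; exact contMDiffOn_extChartAt, contMDiffOn_extChartAt_symm m⟩,
    mem_extChartAt_source m⟩

/-- The inverse function theorem for maps from a vector space to a manifold. -/
theorem isLocalDiffeomorphAt_of_bijective {f : X → N} {s : Set X} (hs : IsOpen s)
    (hf : ContMDiffOn 𝓘(ℝ, X) 𝓘(ℝ, Y) ∞ f s) {p : X} (hp : p ∈ s)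
    (hbij : Function.Bijective (mfderiv 𝓘(ℝ, X) 𝓘(ℝ, Y) f p)) :
    IsLocalDiffeomorphAt 𝓘(ℝ, X) 𝓘(ℝ, Y) ∞ f p := by
  obtain ⟨e, hme⟩ := exists_partialDiffeomorph_chart (Y := Y) (f p)
  have hso : IsOpen (s ∩ f ⁻¹' e.source) := hf.continuousOn.isOpen_inter_preimage hs e.open_source
  have hg : ContMDiffOn 𝓘(ℝ, X) 𝓘(ℝ, Y) ∞ (e ∘ f) (s ∩ f ⁻¹' e.source) :=
    e.contMDiffOn.comp (hf.mono inter_subset_left) fun x hx => hx.2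
  have hfp : MDifferentiableAt 𝓘(ℝ, X) 𝓘(ℝ, Y) f p :=
    (hf.contMDiffAt (hs.mem_nhds hp)).mdifferentiableAt (by simp)
  have hel : IsLocalDiffeomorphAt 𝓘(ℝ, Y) 𝓘(ℝ, Y) ∞ e (f p) := e.isLocalDiffeomorphAt _ _ _ hme
  have hmf : mfderiv 𝓘(ℝ, X) 𝓘(ℝ, Y) (e ∘ f) p =
      (mfderiv 𝓘(ℝ, Y) 𝓘(ℝ, Y) e (f p)).comp (mfderiv 𝓘(ℝ, X) 𝓘(ℝ, Y) f p) :=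
    mfderiv_comp p (e.mdifferentiableAt (by simp) hme) hfp
  have hbij2 : Function.Bijective (fderiv ℝ (e ∘ f) p) := by
    rw [← mfderiv_eq_fderiv, hmf]
    exact (hel.mfderivToContinuousLinearEquiv (by simp)).bijective.comp hbij
  obtain ⟨Φ, hΦ, hsub, hEq⟩ := exists_partialDiffeomorph_of_fderiv hso
    (contMDiffOn_iff_contDiffOn.1 hg) ⟨hp, hme⟩
    (LinearEquiv.ofBijective (fderiv ℝ (e ∘ f) p).toLinearMap hbij2).toContinuousLinearEquiv
    (by ext; rfl)
  refine ⟨Φ.trans e.symm, ⟨hΦ, ?_⟩, fun x hx => ?_⟩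
  · show Φ p ∈ e.target
    rw [← hEq hΦ]
    exact e.map_source hme
  · have h1 := hEq hx.1
    show f x = e.invFun (Φ x)
    rw [← h1]
    exact (e.left_inv (hsub hx.1).2).symm

end InverseFunction

end AlmostSymplectic

namespace AlmostSymplectic

/-! ### The torus as a product manifold -/

section TorusManifold

variable {n : ℕ}

/-- The model vector space of the torus as a product of circles. -/
abbrev TorusModel (n : ℕ) : Type := Fin n → E 1

/-- The torus, with the product of the smooth structures of the circles. -/
noncomputable instance torusChartedSpace (n : ℕ) : ChartedSpace (TorusModel n) (Torus n) :=
  piChartedSpace (fun _ => E 1) (fun _ => Circle)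

/-- Transition maps are products of those of the circle. The structure is needed because the torus
is the typical fiber of the local trivializations. -/
instance torusIsManifold (n : ℕ) : IsManifold 𝓘(ℝ, TorusModel n) ∞ (Torus n) := by
  refine isManifold_of_contDiffOn _ _ _ ?_
  rintro _ _ ⟨e, he, rfl⟩ ⟨e', he', rfl⟩
  refine contDiffOn_pi.2 fun i => ?_
  have h1 := (contDiffGroupoid ∞ (𝓡 1)).compatible (he i trivial) (he' i trivial)
  rw [contDiffGroupoid, mem_groupoid_of_pregroupoid, contDiffPregroupoid] at h1
  have h2 : ContDiffOn ℝ ∞ ((e i).symm ≫ₕ e' i) ((e i).symm ≫ₕ e' i).source := by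
    simpa [contDiffPregroupoid] using! h1.1
  refine h2.comp (contDiff_apply ℝ (E 1) i).contDiffOn ?_
  rintro t ⟨⟨ht, ht'⟩, -⟩
  exact ⟨ht i trivial, ht' i trivial⟩

theorem contMDiff_torus_apply (i : Fin n) :
    ContMDiff 𝓘(ℝ, TorusModel n) (𝓡 1) ∞ (fun β : Torus n => β i) := by
  intro β
  rw [contMDiffAt_iff]
  refine ⟨(continuous_apply i).continuousAt, ?_⟩
  have h1 : ContDiffOn ℝ ∞
      (fun t : TorusModel n => chartAt (E 1) (β i) ((chartAt (E 1) (β i)).symm (t i)))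
      (chartAt (TorusModel n) β).target := by
    refine (contDiff_apply ℝ (E 1) i).contDiffOn.congr fun t ht => ?_
    exact (chartAt (E 1) (β i)).right_inv (ht i trivial)
  simpa using! (h1.contDiffAt ((chartAt (TorusModel n) β).open_target.mem_nhds
    ((chartAt (TorusModel n) β).map_source (mem_chart_source _ β)))).contDiffWithinAt

variable {X : Type*} [NormedAddCommGroup X] [NormedSpace ℝ X] {H : Type*} [TopologicalSpace H]
  {I : ModelWithCorners ℝ X H} {N : Type*} [TopologicalSpace N] [ChartedSpace H N]

theorem contMDiffAt_torus {f : N → Torus n} {x : N}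
    (hf : ∀ i, ContMDiffAt I (𝓡 1) ∞ (fun y => f y i) x) :
    ContMDiffAt I 𝓘(ℝ, TorusModel n) ∞ f x := by
  rw [contMDiffAt_iff_target]
  refine ⟨continuousAt_pi.2 fun i => (hf i).continuousAt, ?_⟩
  refine contMDiffAt_pi_space.2 fun i => ?_
  exact (contMDiffAt_iff_target.1 (hf i)).2

end TorusManifold

end AlmostSymplectic

namespace AlmostSymplectic

/-! ### Derivatives in the model spaces, and integral curves -/

section Derivative

variable {X : Type*} [NormedAddCommGroup X] [NormedSpace ℝ X] {H : Type*} [TopologicalSpace H]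
  {I : ModelWithCorners ℝ X H} {N : Type*} [TopologicalSpace N] [ChartedSpace H N]
  {X' : Type*} [NormedAddCommGroup X'] [NormedSpace ℝ X'] {H' : Type*} [TopologicalSpace H']
  {I' : ModelWithCorners ℝ X' H'} {N' : Type*} [TopologicalSpace N'] [ChartedSpace H' N']
  {X'' : Type*} [NormedAddCommGroup X''] [NormedSpace ℝ X''] {H'' : Type*} [TopologicalSpace H'']
  {I'' : ModelWithCorners ℝ X'' H''} {N'' : Type*} [TopologicalSpace N''] [ChartedSpace H'' N'']

variable (I I') in
/-- The derivative of a map of manifolds, as a map between the model vector spaces. -/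
noncomputable def mder (f : N → N') (x : N) : X →L[ℝ] X' := mfderiv I I' f x

theorem mder_comp {g : N' → N''} {f : N → N'} {x : N} (hg : MDifferentiableAt I' I'' g (f x))
    (hf : MDifferentiableAt I I' f x) :
    mder I I'' (fun y => g (f y)) x = (mder I' I'' g (f x)).comp (mder I I' f x) :=
  mfderiv_comp x hg hf

theorem mder_comp_apply {g : N' → N''} {f : N → N'} {x : N}
    (hg : MDifferentiableAt I' I'' g (f x)) (hf : MDifferentiableAt I I' f x) (v : X) :
    mder I I'' (fun y => g (f y)) x v = mder I' I'' g (f x) (mder I I' f x v) := by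
  rw [mder_comp hg hf]; rfl

theorem mder_congr {f g : N → N'} {x : N} (h : f =ᶠ[𝓝 x] g) : mder I I' f x = mder I I' g x :=
  h.mfderiv_eq

theorem mder_id (x : N) : mder I I (fun y => y) x = ContinuousLinearMap.id ℝ X :=
  mfderiv_id

theorem mder_eq_fderiv (f : X → X') (x : X) : mder 𝓘(ℝ, X) 𝓘(ℝ, X') f x = fderiv ℝ f x :=
  mfderiv_eq_fderiv

theorem mder_const (x : N) (c : N') : mder I I' (fun _ => c) x = 0 :=
  mfderiv_const

theorem hasMFDerivAt_curve_iff {γ : ℝ → N'} {s : ℝ} {v : X'} :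
    HasMFDerivAt 𝓘(ℝ, ℝ) I' γ s ((1 : ℝ →L[ℝ] ℝ).smulRight v : ℝ →L[ℝ] X') ↔
      MDifferentiableAt 𝓘(ℝ, ℝ) I' γ s ∧ mder 𝓘(ℝ, ℝ) I' γ s 1 = v := by
  constructor
  · intro h
    refine ⟨h.mdifferentiableAt, ?_⟩
    have h2 : mder 𝓘(ℝ, ℝ) I' γ s = (1 : ℝ →L[ℝ] ℝ).smulRight v := h.mfderiv
    rw [h2]
    simp
  · rintro ⟨h, rfl⟩
    have h2 : (1 : ℝ →L[ℝ] ℝ).smulRight (mder 𝓘(ℝ, ℝ) I' γ s 1) = mder 𝓘(ℝ, ℝ) I' γ s := by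
      ext; simp
    rw [h2]
    exact h.hasMFDerivAt

theorem isMIntegralCurve_iff {γ : ℝ → N'} {v : ∀ x : N', TangentSpace I' x} :
    IsMIntegralCurve γ v ↔
      ∀ s, MDifferentiableAt 𝓘(ℝ, ℝ) I' γ s ∧ mder 𝓘(ℝ, ℝ) I' γ s 1 = v (γ s) :=
  forall_congr' fun _ => hasMFDerivAt_curve_iff

theorem contDiff_line (t ξ : X) : ContDiff ℝ ∞ (fun s : ℝ => t + s • ξ) := by
  fun_prop

theorem mdifferentiableAt_line (t ξ : X) (s : ℝ) :
    MDifferentiableAt 𝓘(ℝ, ℝ) 𝓘(ℝ, X) (fun s : ℝ => t + s • ξ) s :=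
  ((contDiff_line t ξ).contDiffAt.differentiableAt (by simp)).mdifferentiableAt

theorem mder_line (t ξ : X) (s : ℝ) :
    mder 𝓘(ℝ, ℝ) 𝓘(ℝ, X) (fun s : ℝ => t + s • ξ) s 1 = ξ := by
  have : HasFDerivAt (fun s : ℝ => t + s • ξ) ((1 : ℝ →L[ℝ] ℝ).smulRight ξ) s := by
    simpa using! ((hasFDerivAt_id (𝕜 := ℝ) s).smul_const ξ).const_add t
  rw [mder_eq_fderiv, this.fderiv]
  simp

theorem mder_comp_line {g : X → N'} (t ξ : X) (s : ℝ)
    (hg : MDifferentiableAt 𝓘(ℝ, X) I' g (t + s • ξ)) :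
    MDifferentiableAt 𝓘(ℝ, ℝ) I' (fun s : ℝ => g (t + s • ξ)) s ∧
      mder 𝓘(ℝ, ℝ) I' (fun s : ℝ => g (t + s • ξ)) s 1 = mder 𝓘(ℝ, X) I' g (t + s • ξ) ξ :=
  ⟨hg.comp s (mdifferentiableAt_line t ξ s), by
    rw [mder_comp_apply (f := fun s : ℝ => t + s • ξ) hg (mdifferentiableAt_line t ξ s),
      mder_line]⟩

end Derivative

/-! ### Pointwise algebra of the 2-form -/

section Forms

variable {n : ℕ} {M : Type u} [TopologicalSpace M] [ChartedSpace (E (2 * n)) M]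

theorem contMDiffAt_inner {J : M → E n} {m : M} (hJ : ContMDiffAt (𝓡 (2 * n)) (𝓡 n) ∞ J m)
    (ξ : E n) : ContMDiffAt (𝓡 (2 * n)) 𝓘(ℝ, ℝ) ∞ (fun m => ∑ i, ξ i * J m i) m := by
  have h : ContDiff ℝ ∞ (fun y : E n => ∑ i, ξ i * y i) := by fun_prop
  exact h.contDiffAt.comp_contMDiffAt hJ

theorem mder_inner {J : M → E n} {m : M} (hJ : MDifferentiableAt (𝓡 (2 * n)) (𝓡 n) J m) (ξ : E n)
    (v : E (2 * n)) :
    mder (𝓡 (2 * n)) 𝓘(ℝ, ℝ) (fun m => ∑ i, ξ i * J m i) m v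
      = ∑ i, ξ i * mder (𝓡 (2 * n)) (𝓡 n) J m v i := by
  have h1 : HasFDerivAt (fun y : E n => ∑ i, ξ i * y i)
      (∑ i, ξ i • (EuclideanSpace.proj i : E n →L[ℝ] ℝ)) (J m) :=
    HasFDerivAt.fun_sum fun i _ => ((EuclideanSpace.proj i : E n →L[ℝ] ℝ).hasFDerivAt).const_mul _
  rw [mder_comp_apply (g := fun y : E n => ∑ i, ξ i * y i) h1.hasMFDerivAt.mdifferentiableAt hJ,
    mder_eq_fderiv, h1.fderiv]
  simp

variable [IsManifold (𝓡 (2 * n)) ∞ M]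

/-- The value of a form, as a bilinear form on the model vector space. -/
noncomputable def Form.bil (σ : Form n M) (x : M) : E (2 * n) →L[ℝ] E (2 * n) →L[ℝ] ℝ := σ.val x

theorem Form.bil_self (σ : Form n M) (x : M) (v : E (2 * n)) : σ.bil x v v = 0 :=
  σ.alternating x v

theorem Form.bil_swap (σ : Form n M) (x : M) (v w : E (2 * n)) : σ.bil x v w = - σ.bil x w v := by
  have h := σ.bil_self x (v + w)
  simp only [map_add, add_apply, σ.bil_self] at h
  linarith

theorem Form.eq_of_forall (σ : Form n M) {x : M} {v w : E (2 * n)}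
    (h : ∀ z, σ.bil x v z = σ.bil x w z) : v = w := by
  have h1 : ∀ z : E (2 * n), σ.bil x (v - w) z = 0 := fun z => by
    rw [map_sub, sub_apply, h, sub_self]
  exact sub_eq_zero.1 (σ.nondegenerate x (v - w : E (2 * n)) h1)

theorem IsHamiltonianOf.unique {σ : Form n M} {f : M → ℝ} {X Y : VField n M}
    (hX : IsHamiltonianOf σ f X) (hY : IsHamiltonianOf σ f Y) : X = Y :=
  funext fun m => σ.eq_of_forall fun v => (hX m v).trans (hY m v).symm

/-- The pairing of smooth vector fields through `σ` is smooth. -/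
theorem Form.contMDiffAt_val (σ : Form n M) {X Y : VField n M} {m : M} (hX : SmoothFieldAt X m)
    (hY : SmoothFieldAt Y m) :
    ContMDiffAt (𝓡 (2 * n)) 𝓘(ℝ, ℝ) ∞ (fun x => σ.val x (X x) (Y x)) m := by
  have h := ContMDiffAt.clm_bundle_apply₂ (F₁ := E (2 * n)) (F₂ := E (2 * n)) (F₃ := ℝ)
    (E₁ := TangentSpace (𝓡 (2 * n))) (E₂ := TangentSpace (𝓡 (2 * n)))
    (E₃ := Bundle.Trivial M ℝ) (b := id)
    (σ.smooth m) hX hY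
  rw [Bundle.contMDiffAt_totalSpace] at h
  simpa using! h.2

end Forms

/-! ### Infinitesimal generators and their integral curves -/

namespace TorusAction

variable {n : ℕ} {M : Type u} [TopologicalSpace M] [ChartedSpace (E (2 * n)) M]
  (Ψ : TorusAction n M)

theorem act_torusExp_add (s t : E n) (m : M) :
    Ψ.act (torusExp (s + t)) m = Ψ.act (torusExp s) (Ψ.act (torusExp t) m) := by
  rw [torusExp_add, Ψ.act_mul]

theorem act_inv_act (β : Torus n) (m : M) : Ψ.act β⁻¹ (Ψ.act β m) = m := by
  rw [← Ψ.act_mul, inv_mul_cancel, Ψ.act_one]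

variable {Ψ} in
theorem IsFree.act_injective (h : Ψ.IsFree) (m : M) :
    Function.Injective fun β => Ψ.act β m := fun β γ hβγ => by
  have h1 : Ψ.act (γ⁻¹ * β) m = m := by
    rw [Ψ.act_mul]
    exact (congrArg _ hβγ).trans (Ψ.act_inv_act γ m)
  exact (inv_mul_eq_one.1 (h _ _ h1)).symm

theorem contMDiff_orbit (m : M) :
    ContMDiff (𝓡 n) (𝓡 (2 * n)) ∞ (fun t : E n => Ψ.act (torusExp t) m) :=
  Ψ.smooth.comp (contMDiff_id.prodMk contMDiff_const)

theorem mdifferentiableAt_orbit (m : M) (t : E n) :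
    MDifferentiableAt (𝓡 n) (𝓡 (2 * n)) (fun t : E n => Ψ.act (torusExp t) m) t :=
  (Ψ.contMDiff_orbit m).contMDiffAt.mdifferentiableAt (by simp)

/-- The infinitesimal action at a point, as a linear map of the model vector spaces. -/
noncomputable def gen (m : M) : E n →L[ℝ] E (2 * n) :=
  mder (𝓡 n) (𝓡 (2 * n)) (fun t : E n => Ψ.act (torusExp t) m) 0

theorem generator_eq (m : M) (ξ : E n) : Ψ.generator ξ m = Ψ.gen m ξ := by
  have h2 := (mder_comp_line 0 ξ 0 (Ψ.mdifferentiableAt_orbit m _)).2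
  have h4 : 0 + (0 : ℝ) • ξ = 0 := by simp
  rw [h4] at h2
  simp only [zero_add] at h2
  exact h2

theorem mder_orbit (m : M) (t ξ : E n) :
    mder (𝓡 n) (𝓡 (2 * n)) (fun t : E n => Ψ.act (torusExp t) m) t ξ
      = Ψ.gen (Ψ.act (torusExp t) m) ξ := by
  have h1 : (fun s : E n => Ψ.act (torusExp s) (Ψ.act (torusExp t) m))
      = fun s : E n => Ψ.act (torusExp (t + s)) m := by
    funext s
    rw [← act_torusExp_add, add_comm]
  have h2 : HasFDerivAt (fun s : E n => t + s) (ContinuousLinearMap.id ℝ (E n)) 0 :=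
    (hasFDerivAt_id 0).const_add t
  rw [gen, h1, mder_comp_apply (I' := 𝓡 n) (f := fun s : E n => t + s)
    (g := fun t : E n => Ψ.act (torusExp t) m) (Ψ.mdifferentiableAt_orbit m _)
    h2.differentiableAt.mdifferentiableAt, mder_eq_fderiv, h2.fderiv]
  simp

theorem isMIntegralCurve (m : M) (ξ : E n) :
    IsMIntegralCurve (fun s : ℝ => Ψ.act (torusExp (s • ξ)) m) (Ψ.generator ξ) := by
  refine isMIntegralCurve_iff.2 fun s => ?_
  have h := mder_comp_line 0 ξ s (Ψ.mdifferentiableAt_orbit m _)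
  simp only [zero_add, mder_orbit] at h
  exact ⟨h.1, h.2.trans (Ψ.generator_eq _ ξ).symm⟩

variable [T2Space M] [IsManifold (𝓡 (2 * n)) ∞ M]

/-- Integral curves of a generator are orbits of the corresponding one-parameter subgroup. -/
theorem act_smul_eq_of_isMIntegralCurve {ξ : E n} (hξ : SmoothField (Ψ.generator ξ)) {γ : ℝ → M}
    (hγ : IsMIntegralCurve γ (Ψ.generator ξ)) (s : ℝ) :
    Ψ.act (torusExp (s • ξ)) (γ 0) = γ s :=
  congrFun (isMIntegralCurve_Ioo_eq_of_contMDiff_boundaryless (t₀ := 0)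
    ((show ContMDiff _ _ ∞ _ from hξ).of_le (by simp)) (Ψ.isMIntegralCurve (γ 0) ξ) hγ
    (by simp [Ψ.act_one])) s

theorem act_smul_eq_of_gen_eq_zero {ξ : E n} (hξ : SmoothField (Ψ.generator ξ)) {m : M}
    (h : Ψ.gen m ξ = 0) (s : ℝ) : Ψ.act (torusExp (s • ξ)) m = m := by
  refine Ψ.act_smul_eq_of_isMIntegralCurve hξ (γ := fun _ => m)
    (isMIntegralCurve_iff.2 fun s => ⟨mdifferentiableAt_const, ?_⟩) s
  rw [mder_const]
  exact ((Ψ.generator_eq m ξ).trans h).symm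

variable {Ψ} in
-- If the generator of `ξ` vanishes at `m`, uniqueness of integral curves makes its one-parameter
-- subgroup fix `m`, and freeness makes that subgroup trivial.
theorem IsFree.gen_injective (hΨ : Ψ.IsFree) (hs : ∀ ξ, SmoothField (Ψ.generator ξ)) (m : M) :
    Function.Injective (Ψ.gen m) := by
  rw [injective_iff_map_eq_zero]
  intro ξ hξ
  exact eq_zero_of_forall_torusExp_smul fun s =>
    hΨ _ m (Ψ.act_smul_eq_of_gen_eq_zero (hs ξ) hξ s)

end TorusAction

end AlmostSymplectic

namespace AlmostSymplectic

/-! ### Momentum maps: invariance, submersivity and kernel -/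

namespace TorusAction

variable {n : ℕ} {M : Type u} [TopologicalSpace M] [ChartedSpace (E (2 * n)) M]
  [IsManifold (𝓡 (2 * n)) ∞ M] {σ : Form n M} {Ψ : TorusAction n M} {J : M → E n}

theorem IsFullyHamiltonian.smoothField (h : Ψ.IsFullyHamiltonian σ) (ξ : E n) :
    SmoothField (Ψ.generator ξ) := (h ξ).1.1

namespace IsMomentumMap

theorem mdifferentiableAt (hJ : Ψ.IsMomentumMap σ J) (m : M) :
    MDifferentiableAt (𝓡 (2 * n)) (𝓡 n) J m := hJ.1.contMDiffAt.mdifferentiableAt (by simp)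

theorem bil_gen (hJ : Ψ.IsMomentumMap σ J) (m : M) (ξ : E n) (v : E (2 * n)) :
    σ.bil m (Ψ.gen m ξ) v = - ∑ i, ξ i * mder (𝓡 (2 * n)) (𝓡 n) J m v i := by
  rw [← mder_inner (hJ.mdifferentiableAt m), ← generator_eq]
  exact hJ.2 ξ m v

/-- Along `s ↦ Ψ_{exp(x + sw)}(m)` the function `⟨w, J⟩` has derivative `-σ(Y_w, Y_w) = 0`. -/
theorem sum_mul_act_eq (hJ : Ψ.IsMomentumMap σ J) (m : M) (x w : E n) :
    ∑ i, w i * J (Ψ.act (torusExp (x + w)) m) i = ∑ i, w i * J (Ψ.act (torusExp x) m) i := by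
  set h : ℝ → ℝ := fun s => ∑ i, w i * J (Ψ.act (torusExp (x + s • w)) m) i with hh
  have hγ := fun s : ℝ => mder_comp_line x w s (Ψ.mdifferentiableAt_orbit m _)
  have hF : ∀ y, MDifferentiableAt (𝓡 (2 * n)) 𝓘(ℝ, ℝ) (fun m => ∑ i, w i * J m i) y := fun y =>
    (contMDiffAt_inner hJ.1.contMDiffAt w).mdifferentiableAt (by simp)
  have hd : ∀ s, deriv h s = 0 := fun s => by
    have h1 : mder 𝓘(ℝ, ℝ) 𝓘(ℝ, ℝ) h s 1 = 0 := by
      rw [hh, mder_comp_apply (g := fun m => ∑ i, w i * J m i) (hF _) (hγ s).1, (hγ s).2,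
        mder_orbit, mder_inner (hJ.mdifferentiableAt _), ← neg_eq_zero, ← hJ.bil_gen, σ.bil_self]
    rwa [mder_eq_fderiv] at h1
  have hdiff : Differentiable ℝ h := fun s =>
    mdifferentiableAt_iff_differentiableAt.1 ((hF _).comp s (hγ s).1)
  have := is_const_of_deriv_eq_zero hdiff hd 1 0
  simpa [hh] using this

/-- A momentum map is invariant under the action. -/
theorem act_eq (hJ : Ψ.IsMomentumMap σ J) (β : Torus n) (m : M) : J (Ψ.act β m) = J m := by
  obtain ⟨t, rfl⟩ := torusExp_surjective β
  ext k
  set p : E n := EuclideanSpace.single k (2 * Real.pi) with hp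
  have hp1 : torusExp p = 1 := by
    refine torusExp_eq_one_iff.2 ⟨Pi.single k 1, fun i => ?_⟩
    by_cases hi : i = k
    · subst hi; simp [hp]
    · simp [hp, hi]
  -- Both `t` and `t + p` represent the same torus element, so `J` at the moved point and at `m`
  -- pair equally with `t` and with `t + p`. Subtracting leaves the pairing with `p`, that is `2π`
  -- times the `k`-th component.
  have h1 := hJ.sum_mul_act_eq m 0 t
  have h2 := hJ.sum_mul_act_eq m 0 (t + p)
  rw [zero_add] at h1 h2
  rw [torusExp_add, hp1, mul_one] at h2
  simp only [PiLp.add_apply, add_mul, Finset.sum_add_distrib, h1, torusExp_zero, Ψ.act_one,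
    add_right_inj] at h2
  have h3 : ∀ y : E n, ∑ i, p i * y i = 2 * Real.pi * y k := fun y => by
    rw [Finset.sum_eq_single k]
    · simp [hp]
    · intro i _ hi; simp [hp, hi]
    · simp
  rw [h3, h3] at h2
  exact mul_left_cancel₀ (by positivity) h2

theorem mder_gen (hJ : Ψ.IsMomentumMap σ J) (m : M) (ξ : E n) :
    mder (𝓡 (2 * n)) (𝓡 n) J m (Ψ.gen m ξ) = 0 := by
  have h1 : (fun t : E n => J (Ψ.act (torusExp t) m)) = fun _ => J m :=
    funext fun t => hJ.act_eq _ m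
  have h2 := mder_comp_apply (x := (0 : E n)) (f := fun t : E n => Ψ.act (torusExp t) m)
    (hJ.mdifferentiableAt _) (Ψ.mdifferentiableAt_orbit m 0) ξ
  rw [h1, mder_const, mder_orbit, torusExp_zero, Ψ.act_one] at h2
  exact h2.symm

variable [T2Space M]

/-- A vector `ξ` orthogonal to the range of `dJ` satisfies `σ(Y_ξ, ·) = 0` at `m`. Hence `Y_ξ(m) =
0`, and `ξ = 0` by freeness. -/
theorem mder_surjective (hJ : Ψ.IsMomentumMap σ J) (hΨ : Ψ.IsFree)
    (hσ : Ψ.IsFullyHamiltonian σ) (m : M) :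
    Function.Surjective (mder (𝓡 (2 * n)) (𝓡 n) J m) := by
  rw [← LinearMap.coe_coe, ← LinearMap.range_eq_top, ← Submodule.orthogonal_eq_bot_iff,
    Submodule.eq_bot_iff]
  intro ξ hξ
  have h1 : Ψ.gen m ξ = 0 := by
    refine σ.eq_of_forall (x := m) fun v => ?_
    rw [hJ.bil_gen, map_zero, zero_apply, neg_eq_zero]
    have := (Submodule.mem_orthogonal _ _).1 hξ _ (LinearMap.mem_range_self _ v)
    rw [PiLp.inner_apply] at this
    simpa [mul_comm] using this
  exact hΨ.gen_injective hσ.smoothField m (h1.trans (map_zero _).symm)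

theorem finrank_ker (hJ : Ψ.IsMomentumMap σ J) (hΨ : Ψ.IsFree)
    (hσ : Ψ.IsFullyHamiltonian σ) (m : M) :
    Module.finrank ℝ (mder (𝓡 (2 * n)) (𝓡 n) J m).ker = n := by
  have h1 := (mder (𝓡 (2 * n)) (𝓡 n) J m).toLinearMap.finrank_range_add_finrank_ker
  rw [LinearMap.range_eq_top.2 (hJ.mder_surjective hΨ hσ m)] at h1
  simp only [finrank_top, finrank_euclideanSpace, Fintype.card_fin] at h1
  have h2 : Module.finrank ℝ (mder (𝓡 (2 * n)) (𝓡 n) J m).ker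
    = Module.finrank ℝ (mder (𝓡 (2 * n)) (𝓡 n) J m).toLinearMap.ker := rfl
  omega

/-- The tangent space of the orbit lies in the kernel of `dJ` by invariance, and both have dimension
`n`. -/
theorem exists_gen_eq (hJ : Ψ.IsMomentumMap σ J) (hΨ : Ψ.IsFree)
    (hσ : Ψ.IsFullyHamiltonian σ) (m : M) {v : E (2 * n)}
    (hv : mder (𝓡 (2 * n)) (𝓡 n) J m v = 0) : ∃ ξ, Ψ.gen m ξ = v := by
  have h1 : (Ψ.gen m).toLinearMap.range ≤ (mder (𝓡 (2 * n)) (𝓡 n) J m).toLinearMap.ker := by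
    rintro _ ⟨ξ, rfl⟩
    exact hJ.mder_gen m ξ
  have h2 := Submodule.eq_of_le_of_finrank_eq h1 (by
    rw [LinearMap.finrank_range_of_inj (hΨ.gen_injective hσ.smoothField m)]
    simpa using (hJ.finrank_ker hΨ hσ m).symm)
  have h3 : v ∈ (Ψ.gen m).toLinearMap.range := by
    rw [h2]
    exact hv
  exact h3

end IsMomentumMap

end TorusAction

/-! ### Local sections of submersions -/

section Submersion

variable {k l : ℕ} {M : Type u} [TopologicalSpace M] [ChartedSpace (E k) M]
  [IsManifold (𝓡 k) ∞ M] {J : M → E l}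

/-- A submersion to a vector space has local sections. -/
theorem exists_local_section (hJ : ContMDiff (𝓡 k) (𝓡 l) ∞ J) (m : M)
    (hm : Function.Surjective (mder (𝓡 k) (𝓡 l) J m)) :
    ∃ (s : E l → M) (A : Set (E l)), IsOpen A ∧ J m ∈ A ∧ s (J m) = m ∧
      ContMDiffOn (𝓡 l) (𝓡 k) ∞ s A ∧ ∀ a ∈ A, J (s a) = a := by
  obtain ⟨e, hme⟩ := exists_partialDiffeomorph_chart (Y := E k) m
  have het : e m ∈ e.target := e.map_source hme
  have hem : e.symm (e m) = m := e.left_inv hme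
  have hsd : MDifferentiableAt (𝓡 k) (𝓡 k) e.symm (e m) :=
    e.symm.mdifferentiableAt (by simp) het
  have hG : ContDiffOn ℝ ∞ (fun y => J (e.symm y)) e.target :=
    contMDiffOn_iff_contDiffOn.1 (hJ.comp_contMDiffOn e.symm.contMDiffOn)
  have hGd : HasFDerivAt (fun y => J (e.symm y)) (fderiv ℝ (fun y => J (e.symm y)) (e m)) (e m) :=
    ((hG.contDiffAt (e.open_target.mem_nhds het)).differentiableAt (by simp)).hasFDerivAt
  set D := fderiv ℝ (fun y => J (e.symm y)) (e m) with hD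
  have hDs : Function.Surjective D := by
    have h1 : D = (mder (𝓡 k) (𝓡 l) J (e.symm (e m))).comp (mder (𝓡 k) (𝓡 k) e.symm (e m)) := by
      rw [hD, ← mder_eq_fderiv]
      exact mder_comp (hJ.contMDiffAt.mdifferentiableAt (by simp)) hsd
    have h2 : Function.Surjective (mder (𝓡 k) (𝓡 k) e.symm (e m)) :=
      ((e.symm.isLocalDiffeomorphAt _ _ _ het).mfderivToContinuousLinearEquiv
        (by simp)).surjective
    rw [h1, hem]
    exact hm.comp h2
  -- On the slice `e m + R y` the map `J` has derivative `D ∘ R = id`, so it can be inverted there;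
  -- the inverse is the section.
  obtain ⟨R, hR⟩ := D.toLinearMap.exists_rightInverse_of_surjective (LinearMap.range_eq_top.2 hDs)
  set R' : E l →L[ℝ] E k := LinearMap.toContinuousLinearMap R with hR'
  have hDR : D.comp R' = ContinuousLinearMap.id ℝ (E l) := by
    ext1 y
    exact LinearMap.congr_fun hR y
  have hR1 : ContDiff ℝ ∞ (fun y => e m + R' y) := contDiff_const.add R'.contDiff
  have hopen : IsOpen ((fun y => e m + R' y) ⁻¹' e.target) := e.open_target.preimage hR1.continuous
  have h0 : (0 : E l) ∈ (fun y => e m + R' y) ⁻¹' e.target := by simpa using het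
  obtain ⟨Φ, hΦ0, hΦs, hΦ⟩ := exists_partialDiffeomorph_of_fderiv hopen
    (f := fun y => J (e.symm (e m + R' y)))
    (hG.comp hR1.contDiffOn fun y hy => hy) h0 (ContinuousLinearEquiv.refl ℝ (E l)) (by
      have h1 : HasFDerivAt (fun y => e m + R' y) R' 0 := R'.hasFDerivAt.const_add _
      have h2 : HasFDerivAt (fun y => J (e.symm y)) D (e m + R' 0) := by simpa using hGd
      exact (h2.comp (0 : E l) h1).fderiv.trans hDR)
  have hJm : Φ 0 = J m := by
    rw [← hΦ hΦ0]
    simp only [map_zero, add_zero]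
    rw [hem]
  refine ⟨fun a => e.symm (e m + R' (Φ.symm a)), Φ.target, Φ.open_target, ?_, ?_, ?_, ?_⟩
  · rw [← hJm]; exact Φ.map_source hΦ0
  · have : Φ.symm (J m) = 0 := by rw [← hJm]; exact Φ.left_inv hΦ0
    show e.symm (e m + R' (Φ.symm (J m))) = m
    rw [this, map_zero, add_zero, hem]
  · refine e.symm.contMDiffOn.comp (hR1.contMDiff.comp_contMDiffOn Φ.symm.contMDiffOn) ?_
    intro a ha
    exact hΦs (Φ.map_target ha)
  · intro a ha
    exact (hΦ (Φ.map_target ha)).trans (Φ.right_inv ha)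

end Submersion

end AlmostSymplectic

namespace AlmostSymplectic

/-! ### Orbit parametrizations and transitivity on fibers -/

namespace TorusAction

section

variable {n : ℕ} {M : Type u} [TopologicalSpace M] [ChartedSpace (E (2 * n)) M]
  (Ψ : TorusAction n M)

/-- Smoothness over `ℝⁿ` descends to the torus through local smooth lifts of its identity map. -/
theorem contMDiff_act :
    ContMDiff (𝓘(ℝ, TorusModel n).prod (𝓡 (2 * n))) (𝓡 (2 * n)) ∞
      (fun p : Torus n × M => Ψ.act p.1 p.2) := by
  rintro ⟨β, m⟩
  obtain ⟨t, ht⟩ := torusExp_surjective β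
  obtain ⟨θ, -, hθ, hθ'⟩ := exists_torus_lift (I := 𝓘(ℝ, TorusModel n)) (f := fun β : Torus n => β)
    (x := β) (fun i => (contMDiff_torus_apply i).contMDiffAt) t ht
  have h : ContMDiffAt (𝓘(ℝ, TorusModel n).prod (𝓡 (2 * n))) ((𝓡 n).prod (𝓡 (2 * n))) ∞
      (fun p : Torus n × M => (θ p.1, p.2)) (β, m) :=
    (hθ.comp_of_eq contMDiffAt_fst rfl).prodMk contMDiffAt_snd
  have h2 := Ψ.smooth.contMDiffAt.comp (β, m) h
  refine h2.congr_of_eventuallyEq (.of_forall fun p => ?_)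
  simp [hθ']

theorem continuous_act_left (m : M) : Continuous fun β : Torus n => Ψ.act β m :=
  Ψ.contMDiff_act.continuous.comp (by fun_prop : Continuous fun β : Torus n => (β, m))

/-- The map `(a, t) ↦ Ψ_{exp t} (s a)` associated to a map `s`. -/
noncomputable def orbitParam (s : E n → M) (p : E n × E n) : M := Ψ.act (torusExp p.2) (s p.1)

theorem contMDiffOn_orbitParam {s : E n → M} {A : Set (E n)}
    (hs : ContMDiffOn (𝓡 n) (𝓡 (2 * n)) ∞ s A) :
    ContMDiffOn 𝓘(ℝ, E n × E n) (𝓡 (2 * n)) ∞ (Ψ.orbitParam s) (A ×ˢ univ) := by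
  have h1 : ContMDiffOn 𝓘(ℝ, E n × E n) (𝓡 n) ∞ (fun p : E n × E n => p.2) (A ×ˢ univ) :=
    contDiff_snd.contMDiff.contMDiffOn
  have h2 : ContMDiffOn 𝓘(ℝ, E n × E n) (𝓡 (2 * n)) ∞ (fun p : E n × E n => s p.1)
      (A ×ˢ univ) :=
    hs.comp (contDiff_fst.contMDiff.contMDiffOn (I := 𝓘(ℝ, E n × E n))) fun p hp => hp.1
  exact Ψ.smooth.comp_contMDiffOn (h1.prodMk h2)

theorem mdifferentiableAt_orbitParam {s : E n → M} {A : Set (E n)} (hA : IsOpen A)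
    (hs : ContMDiffOn (𝓡 n) (𝓡 (2 * n)) ∞ s A) {p : E n × E n} (hp : p.1 ∈ A) :
    MDifferentiableAt 𝓘(ℝ, E n × E n) (𝓡 (2 * n)) (Ψ.orbitParam s) p :=
  ((Ψ.contMDiffOn_orbitParam hs).contMDiffAt
    ((hA.prod isOpen_univ).mem_nhds ⟨hp, trivial⟩)).mdifferentiableAt (by simp)

theorem mder_orbitParam_snd {s : E n → M} {A : Set (E n)} (hA : IsOpen A)
    (hs : ContMDiffOn (𝓡 n) (𝓡 (2 * n)) ∞ s A) {p : E n × E n} (hp : p.1 ∈ A) (τ : E n) :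
    mder 𝓘(ℝ, E n × E n) (𝓡 (2 * n)) (Ψ.orbitParam s) p (0, τ)
      = Ψ.gen (Ψ.orbitParam s p) τ := by
  have h1 : HasFDerivAt (fun t : E n => (p.1, t)) (ContinuousLinearMap.inr ℝ (E n) (E n)) p.2 :=
    hasFDerivAt_prodMk_right _ _
  have h2 := mder_comp_apply (I := 𝓡 n) (I' := 𝓘(ℝ, E n × E n)) (I'' := 𝓡 (2 * n))
    (g := Ψ.orbitParam s) (f := fun t : E n => (p.1, t))
    (x := p.2) (Ψ.mdifferentiableAt_orbitParam hA hs hp) h1.differentiableAt.mdifferentiableAt τ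
  rw [mder_eq_fderiv, h1.fderiv] at h2
  exact h2.symm.trans (Ψ.mder_orbit (s p.1) p.2 τ)

end

variable {n : ℕ} {M : Type u} [TopologicalSpace M] [ChartedSpace (E (2 * n)) M]
  [IsManifold (𝓡 (2 * n)) ∞ M] {σ : Form n M} {Ψ : TorusAction n M} {J : M → E n}
  {s : E n → M} {A : Set (E n)}

namespace IsMomentumMap

theorem apply_orbitParam (hJ : Ψ.IsMomentumMap σ J) (hJs : ∀ a ∈ A, J (s a) = a) {p : E n × E n}
    (hp : p.1 ∈ A) : J (Ψ.orbitParam s p) = p.1 := by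
  rw [orbitParam, hJ.act_eq, hJs _ hp]

theorem mder_mder_orbitParam (hJ : Ψ.IsMomentumMap σ J) (hJs : ∀ a ∈ A, J (s a) = a)
    (hA : IsOpen A) (hs : ContMDiffOn (𝓡 n) (𝓡 (2 * n)) ∞ s A) {p : E n × E n} (hp : p.1 ∈ A)
    (w : E n × E n) :
    mder (𝓡 (2 * n)) (𝓡 n) J (Ψ.orbitParam s p)
      (mder 𝓘(ℝ, E n × E n) (𝓡 (2 * n)) (Ψ.orbitParam s) p w) = w.1 := by
  have h1 : (fun q => J (Ψ.orbitParam s q)) =ᶠ[𝓝 p] fun q => q.1 := by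
    filter_upwards [(hA.prod isOpen_univ).mem_nhds (show p ∈ A ×ˢ univ from ⟨hp, trivial⟩)] with q hq
    exact hJ.apply_orbitParam hJs hq.1
  rw [← mder_comp_apply (hJ.mdifferentiableAt _) (Ψ.mdifferentiableAt_orbitParam hA hs hp),
    mder_congr h1, mder_eq_fderiv, fderiv_fst]
  rfl

variable [T2Space M]

/-- Applying `dJ` to the image of a kernel vector `(u, τ)` gives `u = 0`; then `Y_τ = 0` and `τ =
0`. Both sides have dimension `2n`. -/
theorem mder_orbitParam_bijective (hJ : Ψ.IsMomentumMap σ J) (hΨ : Ψ.IsFree)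
    (hσ : Ψ.IsFullyHamiltonian σ) (hJs : ∀ a ∈ A, J (s a) = a)
    (hA : IsOpen A) (hs : ContMDiffOn (𝓡 n) (𝓡 (2 * n)) ∞ s A) {p : E n × E n} (hp : p.1 ∈ A) :
    Function.Bijective (mder 𝓘(ℝ, E n × E n) (𝓡 (2 * n)) (Ψ.orbitParam s) p) := by
  have hinj : Function.Injective (mder 𝓘(ℝ, E n × E n) (𝓡 (2 * n)) (Ψ.orbitParam s) p) := by
    rw [injective_iff_map_eq_zero]
    rintro ⟨u, τ⟩ h
    have h1 := hJ.mder_mder_orbitParam hJs hA hs hp (u, τ)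
    rw [h, map_zero] at h1
    obtain rfl : 0 = u := h1
    rw [Ψ.mder_orbitParam_snd hA hs hp] at h
    rw [hΨ.gen_injective hσ.smoothField _ (h.trans (map_zero _).symm)]
    rfl
  refine ⟨hinj, ?_⟩
  refine (LinearMap.injective_iff_surjective_of_finrank_eq_finrank (f := ContinuousLinearMap.toLinearMap
    (mder 𝓘(ℝ, E n × E n) (𝓡 (2 * n)) (Ψ.orbitParam s) p)) ?_).1 hinj
  simp [two_mul]

theorem isLocalDiffeomorphAt_orbitParam (hJ : Ψ.IsMomentumMap σ J) (hΨ : Ψ.IsFree)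
    (hσ : Ψ.IsFullyHamiltonian σ) (hJs : ∀ a ∈ A, J (s a) = a)
    (hA : IsOpen A) (hs : ContMDiffOn (𝓡 n) (𝓡 (2 * n)) ∞ s A) {p : E n × E n} (hp : p.1 ∈ A) :
    IsLocalDiffeomorphAt 𝓘(ℝ, E n × E n) (𝓡 (2 * n)) ∞ (Ψ.orbitParam s) p :=
  isLocalDiffeomorphAt_of_bijective (hA.prod isOpen_univ) (Ψ.contMDiffOn_orbitParam hs)
    ⟨hp, trivial⟩ (hJ.mder_orbitParam_bijective hΨ hσ hJs hA hs hp)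

theorem exists_section (hJ : Ψ.IsMomentumMap σ J) (hΨ : Ψ.IsFree) (hσ : Ψ.IsFullyHamiltonian σ)
    (m : M) : ∃ (s : E n → M) (A : Set (E n)), IsOpen A ∧ J m ∈ A ∧ s (J m) = m ∧
      ContMDiffOn (𝓡 n) (𝓡 (2 * n)) ∞ s A ∧ ∀ a ∈ A, J (s a) = a :=
  exists_local_section hJ.1 m (hJ.mder_surjective hΨ hσ m)

theorem isOpen_range (hJ : Ψ.IsMomentumMap σ J) (hΨ : Ψ.IsFree) (hσ : Ψ.IsFullyHamiltonian σ) :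
    IsOpen (range J) := by
  refine isOpen_iff_mem_nhds.2 ?_
  rintro _ ⟨m, rfl⟩
  obtain ⟨s, A, hA, hm, -, -, h⟩ := hJ.exists_section hΨ hσ m
  exact Filter.mem_of_superset (hA.mem_nhds hm) fun a ha => ⟨s a, h a ha⟩

/-- The action is transitive on the connected fibers of its momentum map. -/
theorem exists_act_eq (hJ : Ψ.IsMomentumMap σ J) (hΨ : Ψ.IsFree) (hσ : Ψ.IsFullyHamiltonian σ)
    (hconn : ∀ a : E n, IsPreconnected (J ⁻¹' {a})) {m m' : M} (h : J m' = J m) :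
    ∃ β, Ψ.act β m = m' := by
  -- Lying on the same orbit is an equivalence relation, so on a connected fiber it suffices that
  -- each orbit contains a neighbourhood of each of its points in the fiber.
  refine (hconn (J m)).induction₂ (fun x y => ∃ β, Ψ.act β x = y) ?_ ?_ ?_ rfl h
  · intro x _
    obtain ⟨s, A, hA, hx, hsx, hs, hJs⟩ := hJ.exists_section hΨ hσ x
    have hloc := hJ.isLocalDiffeomorphAt_orbitParam hΨ hσ hJs hA hs (p := (J x, 0)) hx
    have hpx : Ψ.orbitParam s (J x, 0) = x := by
      rw [orbitParam, torusExp_zero, Ψ.act_one, hsx]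
    have hinv := hloc.localInverse_eventuallyEq_right
    have hcont := hloc.localInverse_contMDiffAt.continuousAt
    have hli : hloc.localInverse (Ψ.orbitParam s (J x, 0)) = (J x, 0) :=
      hloc.localInverse_left_inv hloc.localInverse_mem_target
    have hev : ∀ᶠ y in 𝓝 (Ψ.orbitParam s (J x, 0)), (hloc.localInverse y).1 ∈ A :=
      hcont.eventually ((hA.preimage continuous_fst).mem_nhds (by
        show (hloc.localInverse (Ψ.orbitParam s (J x, 0))).1 ∈ A
        rw [hli]; exact hx))
    rw [hpx] at hinv hev
    filter_upwards [mem_nhdsWithin_of_mem_nhds hinv, mem_nhdsWithin_of_mem_nhds hev,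
      self_mem_nhdsWithin] with y hy hyA hyF
    -- The first coordinate of `y` in the orbit parametrization is `J y = J x`, so `y` is a
    -- translate of `s (J x) = x` by its second coordinate.
    refine ⟨torusExp (hloc.localInverse y).2, ?_⟩
    have h1 : Ψ.orbitParam s (hloc.localInverse y) = y := hy
    have h2 := hJ.apply_orbitParam hJs hyA
    rw [h1] at h2
    have h3 : J y = J x := by
      rw [mem_preimage, mem_singleton_iff] at hyF
      rw [hyF]; symm; assumption
    nth_rw 2 [← h1]
    rw [orbitParam, ← h2, h3, hsx]
  · rintro x y z - - - ⟨β, rfl⟩ ⟨γ, rfl⟩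
    exact ⟨γ * β, Ψ.act_mul _ _ _⟩
  · rintro x y - - ⟨β, rfl⟩
    exact ⟨β⁻¹, Ψ.act_inv_act β x⟩

end IsMomentumMap

end TorusAction

end AlmostSymplectic

namespace AlmostSymplectic

/-! ### Coordinate vector fields of a local parametrization -/

section Frame

variable {n : ℕ} {M : Type u} [TopologicalSpace M] [ChartedSpace (E (2 * n)) M]
  {X : Type*} [NormedAddCommGroup X] [NormedSpace ℝ X]

/-- Constant vector fields on a vector space. -/
def constField (w : X) : ∀ p : X, TangentSpace 𝓘(ℝ, X) p := fun _ => w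

theorem contMDiffAt_constField (w p : X) :
    ContMDiffAt 𝓘(ℝ, X) 𝓘(ℝ, X).tangent ∞
      (fun x => (⟨x, constField w x⟩ : TangentBundle 𝓘(ℝ, X) X)) p :=
  contMDiffAt_vectorSpace_iff_contDiffAt.2 contDiffAt_const

/-- The coordinate vector fields of a local parametrization. -/
noncomputable def frame (Φ : PartialDiffeomorph 𝓘(ℝ, X) (𝓡 (2 * n)) X M ∞) (w : X) : VField n M :=
  VectorField.mpullback (𝓡 (2 * n)) 𝓘(ℝ, X) Φ.symm (constField w)

variable (Φ : PartialDiffeomorph 𝓘(ℝ, X) (𝓡 (2 * n)) X M ∞)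

theorem isInvertible_mfderiv_symm {m : M} (hm : m ∈ Φ.target) :
    (mfderiv (𝓡 (2 * n)) 𝓘(ℝ, X) Φ.symm m).IsInvertible :=
  ⟨(Φ.symm.isLocalDiffeomorphAt _ _ _ hm).mfderivToContinuousLinearEquiv (by simp), rfl⟩

theorem frame_apply {p : X} (hp : p ∈ Φ.source) (w : X) :
    frame Φ w (Φ p) = mder 𝓘(ℝ, X) (𝓡 (2 * n)) Φ p w := by
  have hm : Φ p ∈ Φ.target := Φ.map_source hp
  have hpp : Φ.symm (Φ p) = p := Φ.left_inv hp
  have h1 : (mder (𝓡 (2 * n)) 𝓘(ℝ, X) Φ.symm (Φ p)).comp (mder 𝓘(ℝ, X) (𝓡 (2 * n)) Φ p)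
      = ContinuousLinearMap.id ℝ X := by
    rw [← mder_comp (Φ.symm.mdifferentiableAt (by simp) hm) (Φ.mdifferentiableAt (by simp) hp),
      ← mder_id (I := 𝓘(ℝ, X)) p]
    refine mder_congr ?_
    filter_upwards [Φ.open_source.mem_nhds hp] with q hq using Φ.left_inv hq
  obtain ⟨e, he⟩ := isInvertible_mfderiv_symm Φ hm
  have h2 : frame Φ w (Φ p) = e.symm w := by
    rw [frame, VectorField.mpullback_apply, ← he, ContinuousLinearMap.inverse_equiv]
    rfl
  have h3 : e (mder 𝓘(ℝ, X) (𝓡 (2 * n)) Φ p w) = w := by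
    have := DFunLike.congr_fun he (mder 𝓘(ℝ, X) (𝓡 (2 * n)) Φ p w)
    exact this.trans (DFunLike.congr_fun h1 w)
  rw [h2]
  exact (e.symm_apply_eq.2 h3.symm)

variable [IsManifold (𝓡 (2 * n)) ∞ M]

theorem smoothFieldAt_frame {m : M} (hm : m ∈ Φ.target) (w : X) : SmoothFieldAt (frame Φ w) m := by
  exact ContMDiffAt.mpullback_vectorField_preimage (n := ∞) (contMDiffAt_constField w _)
    (Φ.symm.contMDiffOn.contMDiffAt (Φ.symm.open_source.mem_nhds hm))
    (isInvertible_mfderiv_symm Φ hm) (by simp)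

/-- Pullback commutes with brackets, and constant fields commute. -/
theorem mlieBracket_frame [CompleteSpace X] {m : M} (hm : m ∈ Φ.target) (v w : X) :
    VectorField.mlieBracket (𝓡 (2 * n)) (frame Φ v) (frame Φ w) m = 0 := by
  have h2 : IsManifold (𝓡 (2 * n)) (minSmoothness ℝ 2) M := by
    rw [minSmoothness_of_isRCLikeNormedField]; infer_instance
  have h3 : IsManifold (𝓡 (2 * n)) (minSmoothness ℝ 3) M := by
    rw [minSmoothness_of_isRCLikeNormedField]; exact IsManifold.of_le (n := ∞)
      (WithTop.coe_le_coe.2 (le_top : (3 : ℕ∞) ≤ ⊤))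
  rw [frame, frame, ← VectorField.mpullback_mlieBracket (n := ∞)
    ((contMDiffAt_constField v _).mdifferentiableAt (by simp))
    ((contMDiffAt_constField w _).mdifferentiableAt (by simp))
    (Φ.symm.contMDiffOn.contMDiffAt (Φ.symm.open_source.mem_nhds hm))
    (by rw [minSmoothness_of_isRCLikeNormedField]; exact WithTop.coe_le_coe.2 (le_top : (2 : ℕ∞) ≤ ⊤)),
    VectorField.mpullback_apply]
  have : VectorField.mlieBracket 𝓘(ℝ, X) (constField v) (constField w) (Φ.symm m) = 0 := by
    rw [← VectorField.mlieBracketWithin_univ, VectorField.mlieBracketWithin_eq_lieBracketWithin]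
    change VectorField.lieBracketWithin ℝ (fun _ : X => v) (fun _ : X => w) univ (Φ.symm m) = 0
    simp [VectorField.lieBracketWithin]
  rw [this, map_zero]

end Frame

end AlmostSymplectic

namespace AlmostSymplectic

/-! ### The local representative of the form -/

section

variable {n : ℕ} {M : Type u} [TopologicalSpace M] [ChartedSpace (E (2 * n)) M]
  [IsManifold (𝓡 (2 * n)) ∞ M]

/-- The local representative of `σ` in a local parametrization. -/
noncomputable def Form.pull {X : Type*} [NormedAddCommGroup X] [NormedSpace ℝ X]
    (σ : Form n M) (φ : X → M) (p v w : X) : ℝ :=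
  σ.bil (φ p) (mder 𝓘(ℝ, X) (𝓡 (2 * n)) φ p v) (mder 𝓘(ℝ, X) (𝓡 (2 * n)) φ p w)

theorem Form.pull_eventuallyEq {X : Type*} [NormedAddCommGroup X] [NormedSpace ℝ X]
    (σ : Form n M) {φ : X → M} (Φ : PartialDiffeomorph 𝓘(ℝ, X) (𝓡 (2 * n)) X M ∞)
    (hΦ : EqOn φ Φ Φ.source) {p : X} (hp : p ∈ Φ.source) (v w : X) :
    (fun q => σ.pull φ q v w) =ᶠ[𝓝 p]
      fun q => σ.val (φ q) (frame Φ v (φ q)) (frame Φ w (φ q)) := by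
  filter_upwards [Φ.open_source.mem_nhds hp] with q hq
  have h1 : mder 𝓘(ℝ, X) (𝓡 (2 * n)) φ q = mder 𝓘(ℝ, X) (𝓡 (2 * n)) Φ q :=
    mder_congr (Filter.eventuallyEq_of_mem (Φ.open_source.mem_nhds hq) hΦ)
  rw [hΦ hq, Form.pull, h1, hΦ hq, ← frame_apply Φ hq, ← frame_apply Φ hq]
  rfl

/-- The local representative of a form has smooth coefficients. -/
theorem Form.contDiffAt_pull {X : Type*} [NormedAddCommGroup X] [NormedSpace ℝ X]
    (σ : Form n M) {φ : X → M} {p : X}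
    (hφ : IsLocalDiffeomorphAt 𝓘(ℝ, X) (𝓡 (2 * n)) ∞ φ p) (v w : X) :
    ContDiffAt ℝ ∞ (fun q => σ.pull φ q v w) p := by
  have hsm := hφ.contMDiffAt
  obtain ⟨Φ, hp, hΦ⟩ := hφ
  have hm : φ p ∈ Φ.target := by rw [hΦ hp]; exact Φ.map_source hp
  refine ContDiffAt.congr_of_eventuallyEq ?_ (σ.pull_eventuallyEq Φ hΦ hp v w)
  exact contMDiffAt_iff_contDiffAt.1 (ContMDiffAt.comp p (σ.contMDiffAt_val
    (smoothFieldAt_frame Φ hm v) (smoothFieldAt_frame Φ hm w)) hsm)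

end

namespace TorusAction

variable {n : ℕ} {M : Type u} [TopologicalSpace M] [ChartedSpace (E (2 * n)) M]
  [IsManifold (𝓡 (2 * n)) ∞ M] {σ : Form n M} {Ψ : TorusAction n M} {J : M → E n}
  {s : E n → M} {A : Set (E n)}

namespace IsMomentumMap

/-- The momentum map condition settles every coefficient involving an angle: the orbits are
isotropic, and actions and angles pair canonically. -/
theorem pull_snd (hJ : Ψ.IsMomentumMap σ J) (hJs : ∀ a ∈ A, J (s a) = a)
    (hA : IsOpen A) (hs : ContMDiffOn (𝓡 n) (𝓡 (2 * n)) ∞ s A) {p : E n × E n} (hp : p.1 ∈ A)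
    (τ : E n) (w : E n × E n) :
    σ.pull (Ψ.orbitParam s) p (0, τ) w = - ∑ i, τ i * w.1 i := by
  rw [Form.pull, Ψ.mder_orbitParam_snd hA hs hp, hJ.bil_gen, hJ.mder_mder_orbitParam hJs hA hs hp]

variable [T2Space M]

/-- The invariance of `σ`, in terms of its local representative. -/
theorem pull_fst_eq (hJ : Ψ.IsMomentumMap σ J) (hΨ : Ψ.IsFree)
    (hσ : Ψ.IsFullyHamiltonian σ) (hJs : ∀ a ∈ A, J (s a) = a)
    (hA : IsOpen A) (hs : ContMDiffOn (𝓡 n) (𝓡 (2 * n)) ∞ s A) {a : E n} (ha : a ∈ A)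
    (v w : E n × E n) (t : E n) :
    σ.pull (Ψ.orbitParam s) (a, t) v w = σ.pull (Ψ.orbitParam s) (a, 0) v w := by
  set h : ℝ → ℝ := fun r => σ.pull (Ψ.orbitParam s) ((a, 0) + r • (0, t)) v w with hh
  have hp : ∀ r : ℝ, ((a, (0 : E n)) + r • ((0 : E n), t)).1 ∈ A := fun r => by simpa using ha
  have hd : ∀ r, HasDerivAt h 0 r := by
    intro r
    set p := (a, (0 : E n)) + r • ((0 : E n), t) with hpd
    have hloc := hJ.isLocalDiffeomorphAt_orbitParam hΨ hσ hJs hA hs (hp r)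
    have hf := σ.contDiffAt_pull hloc v w
    have hl := mder_comp_line (a, (0 : E n)) ((0 : E n), t) r
      (g := fun q => σ.pull (Ψ.orbitParam s) q v w)
      (hf.differentiableAt (by simp)).mdifferentiableAt
    have h1 : HasDerivAt h (mder 𝓘(ℝ, E n × E n) 𝓘(ℝ, ℝ)
        (fun q => σ.pull (Ψ.orbitParam s) q v w) p ((0 : E n), t)) r := by
      rw [← hl.2, mder_eq_fderiv]
      exact (mdifferentiableAt_iff_differentiableAt.1 hl.1).hasDerivAt
    convert h1 using 1
    obtain ⟨Φ, hpΦ, hΦ⟩ := id hloc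
    have hm : Ψ.orbitParam s p ∈ Φ.target := by rw [hΦ hpΦ]; exact Φ.map_source hpΦ
    -- Near the point the generator is itself a coordinate field, so its brackets with `frame Φ v`
    -- and `frame Φ w` vanish. Then `L_Y σ = 0` says that the coefficient has zero derivative along
    -- `Y`.
    have hgen : Ψ.generator t =ᶠ[𝓝 (Ψ.orbitParam s p)] frame Φ (0, t) := by
      have hev : ∀ᶠ y in 𝓝 (Ψ.orbitParam s p), (Φ.symm y).1 ∈ A := by
        have hc : ContinuousAt Φ.symm (Ψ.orbitParam s p) :=
          (Φ.symm.contMDiffOn.contMDiffAt (Φ.open_target.mem_nhds hm)).continuousAt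
        refine hc.eventually ((hA.preimage continuous_fst).mem_nhds ?_)
        have : Φ.symm (Ψ.orbitParam s p) = p := by rw [hΦ hpΦ]; exact Φ.left_inv hpΦ
        rw [this]
        exact hp r
      filter_upwards [Φ.open_target.mem_nhds hm, hev] with y hy hyA
      have hq : Φ.symm y ∈ Φ.source := Φ.map_target hy
      have hyq : Φ (Φ.symm y) = y := Φ.right_inv hy
      have h1 : mder 𝓘(ℝ, E n × E n) (𝓡 (2 * n)) (Ψ.orbitParam s) (Φ.symm y)
          = mder 𝓘(ℝ, E n × E n) (𝓡 (2 * n)) Φ (Φ.symm y) :=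
        mder_congr (Filter.eventuallyEq_of_mem (Φ.open_source.mem_nhds hq) hΦ)
      have h2 := frame_apply Φ hq (0, t)
      rw [← h1, Ψ.mder_orbitParam_snd hA hs hyA, hΦ hq, hyq] at h2
      exact (Ψ.generator_eq y t).trans h2.symm
    have hval : MDifferentiableAt (𝓡 (2 * n)) 𝓘(ℝ, ℝ)
        (fun x => σ.val x (frame Φ v x) (frame Φ w x)) (Ψ.orbitParam s p) :=
      (σ.contMDiffAt_val (smoothFieldAt_frame Φ hm v)
        (smoothFieldAt_frame Φ hm w)).mdifferentiableAt (by simp)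
    have hLie := (hσ t).2 (Ψ.orbitParam s p) (frame Φ v) (frame Φ w)
      (smoothFieldAt_frame Φ hm v) (smoothFieldAt_frame Φ hm w)
    have hb : ∀ w, VectorField.mlieBracket (𝓡 (2 * n)) (Ψ.generator t) (frame Φ w)
        (Ψ.orbitParam s p) = 0 := fun w =>
      (Filter.EventuallyEq.mlieBracket_vectorField_eq hgen (Filter.EventuallyEq.refl _ _)).trans
        (mlieBracket_frame Φ hm _ _)
    rw [lieDeriv, hb, hb] at hLie
    simp only [map_zero, zero_apply, sub_zero] at hLie
    rw [mder_congr (σ.pull_eventuallyEq Φ hΦ hpΦ v w),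
      mder_comp_apply (g := fun x => σ.val x (frame Φ v x) (frame Φ w x)) hval
        (Ψ.mdifferentiableAt_orbitParam hA hs (hp r)), Ψ.mder_orbitParam_snd hA hs (hp r)]
    rw [Ψ.generator_eq] at hLie
    exact hLie.symm
  have := is_const_of_deriv_eq_zero (fun r => (hd r).differentiableAt) (fun r => (hd r).deriv) 1 0
  simpa [hh] using this

/-- The local representative of `σ` in the parametrization given by a section. -/
theorem exists_pull_eq_modelForm (hJ : Ψ.IsMomentumMap σ J) (hΨ : Ψ.IsFree)
    (hσ : Ψ.IsFullyHamiltonian σ) (hJs : ∀ a ∈ A, J (s a) = a)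
    (hA : IsOpen A) (hs : ContMDiffOn (𝓡 n) (𝓡 (2 * n)) ∞ s A) :
    ∃ C : E n → Matrix (Fin n) (Fin n) ℝ,
      (∀ i j, ContDiffOn ℝ ∞ (fun a => C a i j) A) ∧ (∀ a ∈ A, (C a).transpose = - C a) ∧
      ∀ a ∈ A, ∀ t u v, σ.pull (Ψ.orbitParam s) (a, t) u v = modelForm (C a) u v := by
  set e : Fin n → E n := fun i => EuclideanSpace.single i 1 with he
  have hskew : ∀ a i j, σ.pull (Ψ.orbitParam s) (a, 0) (e j, 0) (e i, 0)
      = - σ.pull (Ψ.orbitParam s) (a, 0) (e i, 0) (e j, 0) := fun a i j => σ.bil_swap _ _ _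
  -- The matrix is read off along the section, at `t = 0`; `pull_fst_eq` carries it to all other
  -- angles.
  refine ⟨fun a => Matrix.of fun i j => σ.pull (Ψ.orbitParam s) (a, 0) (e i, 0) (e j, 0),
    ?_, ?_, ?_⟩
  · intro i j a ha
    have h1 := σ.contDiffAt_pull
      (hJ.isLocalDiffeomorphAt_orbitParam hΨ hσ hJs hA hs (p := (a, 0)) ha) (e i, 0) (e j, 0)
    exact (ContDiffAt.comp (f := fun a : E n => (a, (0 : E n))) a h1
      (by fun_prop)).contDiffWithinAt
  · intro a ha
    ext i j
    exact hskew a i j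
  · rintro a ha t ⟨u, u'⟩ ⟨v, v'⟩
    have hadd : ∀ x y z : E n × E n, σ.pull (Ψ.orbitParam s) (a, t) (x + y) z
        = σ.pull (Ψ.orbitParam s) (a, t) x z + σ.pull (Ψ.orbitParam s) (a, t) y z := by
      intro x y z; simp [Form.pull]
    have hswap : ∀ x y : E n × E n, σ.pull (Ψ.orbitParam s) (a, t) x y
        = - σ.pull (Ψ.orbitParam s) (a, t) y x := fun x y => σ.bil_swap _ _ _
    have hsum : σ.pull (Ψ.orbitParam s) (a, t) (u, 0) (v, 0)
        = ∑ i, ∑ j, σ.pull (Ψ.orbitParam s) (a, 0) (e i, 0) (e j, 0) * (u i * v j) := by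
      have hu : ∀ u : E n, (u, (0 : E n)) = ∑ i, u i • (e i, (0 : E n)) := fun u => by
        have h1 : u = ∑ i, u i • e i := by
          conv_lhs => rw [← (EuclideanSpace.basisFun (Fin n) ℝ).sum_repr u]
          simp [he]
        have h2 : (u, (0 : E n)) = ContinuousLinearMap.inl ℝ (E n) (E n) u := rfl
        rw [h2]
        conv_lhs => rw [h1]
        simp
      rw [hJ.pull_fst_eq hΨ hσ hJs hA hs ha, hu u, hu v]
      simp only [Form.pull, map_sum, map_smul, sum_apply, smul_apply, smul_eq_mul,
        Finset.mul_sum]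
      refine (Finset.sum_comm).trans (Finset.sum_congr rfl fun i _ => Finset.sum_congr rfl
        fun j _ => by ring)
    have h1 : ((u, u') : E n × E n) = (u, 0) + (0, u') := by simp
    have h2 : ((v, v') : E n × E n) = (v, 0) + (0, v') := by simp
    rw [h1, hadd, hJ.pull_snd hJs hA hs ha, hswap, h2, hadd, hJ.pull_snd hJs hA hs ha, hswap, hsum]
    -- By skew-symmetry the two halves of the model's double sum coincide, which absorbs the factor
    -- `1 / 2`.
    have hskew2 : ∑ i, ∑ j, σ.pull (Ψ.orbitParam s) (a, 0) (e i, 0) (e j, 0) * (v i * u j)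
        = - ∑ i, ∑ j, σ.pull (Ψ.orbitParam s) (a, 0) (e i, 0) (e j, 0) * (u i * v j) := by
      rw [Finset.sum_comm, ← Finset.sum_neg_distrib]
      refine Finset.sum_congr rfl fun i _ => ?_
      rw [← Finset.sum_neg_distrib]
      refine Finset.sum_congr rfl fun j _ => ?_
      rw [hskew a i j]
      ring
    simp only [modelForm, Prod.fst_add, Prod.snd_add, add_zero, zero_add, mul_sub,
      Finset.sum_sub_distrib, Matrix.of_apply, hskew2, mul_comm (u' _), mul_comm (v' _)]
    ring

end IsMomentumMap

end TorusAction

end AlmostSymplectic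

namespace AlmostSymplectic

/-! ### Action-angle charts and the atlas of a momentum map -/

namespace TorusAction

variable {n : ℕ} {M : Type u} [TopologicalSpace M] [ChartedSpace (E (2 * n)) M]
  [IsManifold (𝓡 (2 * n)) ∞ M] {σ : Form n M} {Ψ : TorusAction n M} {J : M → E n}
  {s : E n → M} {A : Set (E n)}

namespace IsMomentumMap

variable [T2Space M]

/-- The angles relative to a section are smooth. -/
theorem contMDiffAt_angle (hJ : Ψ.IsMomentumMap σ J) (hΨ : Ψ.IsFree)
    (hσ : Ψ.IsFullyHamiltonian σ) (hJs : ∀ a ∈ A, J (s a) = a)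
    (hA : IsOpen A) (hs : ContMDiffOn (𝓡 n) (𝓡 (2 * n)) ∞ s A) {α : M → Torus n}
    (hα : ∀ m ∈ J ⁻¹' A, Ψ.act (α m) (s (J m)) = m) {m : M} (hm : m ∈ J ⁻¹' A) (i : Fin n) :
    ContMDiffAt (𝓡 (2 * n)) (𝓡 1) ∞ (fun m => α m i) m := by
  obtain ⟨t, ht⟩ := torusExp_surjective (α m)
  have hp : Ψ.orbitParam s (J m, t) = m := by rw [orbitParam, ht, hα m hm]
  have hloc := hJ.isLocalDiffeomorphAt_orbitParam hΨ hσ hJs hA hs (p := (J m, t)) hm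
  obtain ⟨Φ, hpΦ, hΦ⟩ := id hloc
  have hmt : m ∈ Φ.target := by
    rw [← hp, hΦ hpΦ]
    exact Φ.map_source hpΦ
  have hmp : Φ.symm m = (J m, t) := by
    nth_rw 1 [← hp]
    rw [hΦ hpΦ]
    exact Φ.left_inv hpΦ
  have hsm : ContMDiffAt (𝓡 (2 * n)) 𝓘(ℝ, E n × E n) ∞ Φ.symm m :=
    Φ.symm.contMDiffOn.contMDiffAt (Φ.open_target.mem_nhds hmt)
  have h1 : ContMDiffAt (𝓡 (2 * n)) (𝓡 n) ∞ (fun y => (Φ.symm y).2) m :=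
    ContMDiffAt.comp (I' := 𝓘(ℝ, E n × E n)) m
      (contDiff_snd (𝕜 := ℝ) (E := E n) (F := E n)).contMDiff.contMDiffAt hsm
  have h2 : ContMDiffAt (𝓡 (2 * n)) (𝓡 1) ∞ (fun y => torusExp (Φ.symm y).2 i) m :=
    (contMDiff_torusExp_apply i).contMDiffAt.comp m h1
  refine h2.congr_of_eventuallyEq ?_
  have hev : ∀ᶠ y in 𝓝 m, (Φ.symm y).1 ∈ A := by
    refine hsm.continuousAt.eventually ((hA.preimage continuous_fst).mem_nhds ?_)
    rw [hmp]
    exact hm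
  filter_upwards [Φ.open_target.mem_nhds hmt, hev] with y hy hyA
  have hq : Ψ.orbitParam s (Φ.symm y) = y :=
    (hΦ (Φ.map_target hy)).trans (Φ.right_inv hy)
  have hJy : J y = (Φ.symm y).1 := by
    conv_lhs => rw [← hq]
    exact hJ.apply_orbitParam hJs hyA
  -- Both torus elements carry `s (J y)` to `y`, so freeness identifies them.
  have h3 : α y = torusExp (Φ.symm y).2 := by
    refine hΨ.act_injective (s (J y)) ?_
    show Ψ.act (α y) (s (J y)) = _
    rw [hα y (by rw [mem_preimage, hJy]; exact hyA), hJy]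
    exact hq.symm
  rw [h3]

/-- The toric chart defined by a section of the momentum map. -/
theorem exists_toricChart (hJ : Ψ.IsMomentumMap σ J) (hΨ : Ψ.IsFree)
    (hσ : Ψ.IsFullyHamiltonian σ) (hconn : ∀ a : E n, IsPreconnected (J ⁻¹' {a}))
    (hJs : ∀ a ∈ A, J (s a) = a)
    (hA : IsOpen A) (hs : ContMDiffOn (𝓡 n) (𝓡 (2 * n)) ∞ s A) :
    ∃ c : ToricChart n M, c.source = J ⁻¹' A ∧ c.actionSet = A ∧ (∀ m, c.action m = J m) ∧
      (∀ p, c.invFun p = Ψ.act p.2 (s p.1)) := by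
  -- The angle of `m` is the torus element leading from the section to `m`; outside the chart domain
  -- the value `1` is arbitrary.
  have hex : ∀ m, ∃ β, m ∈ J ⁻¹' A → Ψ.act β (s (J m)) = m := fun m => by
    by_cases hm : m ∈ J ⁻¹' A
    · obtain ⟨β, hβ⟩ := hJ.exists_act_eq hΨ hσ hconn (m := s (J m)) (m' := m) (hJs _ hm).symm
      exact ⟨β, fun _ => hβ⟩
    · exact ⟨1, fun h => absurd h hm⟩
  choose α hα using hex
  refine ⟨{ toFun := fun m => (J m, α m)
            invFun := fun p => Ψ.act p.2 (s p.1)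
            source := J ⁻¹' A
            target := A ×ˢ univ
            actionSet := A
            map_source' := fun m hm => ⟨hm, trivial⟩
            map_target' := fun p hp => ?_
            left_inv' := fun m hm => hα m hm
            right_inv' := ?_
            isOpen_source := hA.preimage hJ.1.continuous
            isOpen_actionSet := hA
            target_eq := rfl
            smooth_action := hJ.1.contMDiffOn
            smooth_angle := fun i m hm =>
              (hJ.contMDiffAt_angle hΨ hσ hJs hA hs hα hm i).contMDiffWithinAt
            smooth_symm := Ψ.contMDiffOn_orbitParam hs }, rfl, rfl, fun _ => rfl, fun _ => rfl⟩
  · rw [mem_preimage, hJ.act_eq, hJs _ hp.1]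
    exact hp.1
  · rintro ⟨a, β⟩ ⟨ha, -⟩
    have h1 : J (Ψ.act β (s a)) = a := by rw [hJ.act_eq, hJs a ha]
    have h2 : α (Ψ.act β (s a)) = β := by
      refine hΨ.act_injective (s a) ?_
      have h3 := hα (Ψ.act β (s a)) (by rw [mem_preimage, h1]; exact ha)
      rwa [h1] at h3
    exact Prod.ext h1 h2

theorem exists_actionAngleChart (hJ : Ψ.IsMomentumMap σ J) (hΨ : Ψ.IsFree)
    (hσ : Ψ.IsFullyHamiltonian σ) (hconn : ∀ a : E n, IsPreconnected (J ⁻¹' {a}))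
    (hR : IsOpen (range J)) (m : M) :
    ∃ c : ToricChart n M, m ∈ c.source ∧ (∀ m, c.action m = J m) ∧
      IsActionAngleChart σ (ontoImage J hR) c := by
  obtain ⟨s, A, hA, hmA, -, hs, hJs⟩ := hJ.exists_section hΨ hσ m
  obtain ⟨c, hsrc, hset, hact, hinv⟩ := hJ.exists_toricChart hΨ hσ hconn hJs hA hs
  refine ⟨c, by rw [hsrc]; exact hmA, hact, ?_, ?_⟩
  · intro x hx y
    rw [ontoImage, ontoImage, Subtype.mk_eq_mk, hact, hact, hsrc]
    refine ⟨fun h => ⟨?_, h⟩, fun h => h.2⟩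
    rw [hsrc] at hx
    rw [mem_preimage, h]
    exact hx
  · obtain ⟨C, h1, h2, h3⟩ := hJ.exists_pull_eq_modelForm hΨ hσ hJs hA hs
    rw [hset]
    have hpar : c.param = Ψ.orbitParam s := funext fun p => hinv _
    refine ⟨C, h1, h2, ?_⟩
    rw [hpar]
    exact h3

theorem exists_atlas (hJ : Ψ.IsMomentumMap σ J) (hΨ : Ψ.IsFree)
    (hσ : Ψ.IsFullyHamiltonian σ) (hconn : ∀ a : E n, IsPreconnected (J ⁻¹' {a}))
    (hR : IsOpen (range J)) :
    ∃ P : Set (ToricChart n M), IsAtlasWithGlobalActions σ (ontoImage J hR) P ∧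
      globalActionMap P = J := by
  choose c hc1 hc2 hc3 using hJ.exists_actionAngleChart hΨ hσ hconn hR
  have hglob : globalActionMap (range c) = J := by
    funext m
    have h : ∃ d ∈ range c, m ∈ d.source := ⟨c m, ⟨m, rfl⟩, hc1 m⟩
    rw [globalActionMap, dif_pos h]
    obtain ⟨x, hx⟩ := h.choose_spec.1
    rw [← hx, hc2]
  refine ⟨range c, ⟨?_, fun m => ⟨c m, ⟨m, rfl⟩, hc1 m⟩, ?_, ?_⟩, hglob⟩
  · rintro _ ⟨m, rfl⟩
    exact hc3 m
  · rintro _ ⟨x, rfl⟩ _ ⟨y, rfl⟩ m _ _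
    rw [hc2, hc2]
  · rw [hglob]
    exact hconn

end IsMomentumMap

end TorusAction

end AlmostSymplectic

namespace AlmostSymplectic

/-! ### Lie derivative along function combinations of fields -/

section LieDerivative

variable {n : ℕ} {M : Type u} [TopologicalSpace M] [ChartedSpace (E (2 * n)) M]
  [IsManifold (𝓡 (2 * n)) ∞ M]

theorem SmoothFieldAt.mdifferentiableAt {X : VField n M} {m : M} (h : SmoothFieldAt X m) :
    MDifferentiableAt (𝓡 (2 * n)) (𝓡 (2 * n)).tangent
      (fun x => (⟨x, X x⟩ : TangentBundle (𝓡 (2 * n)) M)) m :=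
  ContMDiffAt.mdifferentiableAt (n := ∞) h (by simp)

theorem smoothFieldAt_sum_smul {ι : Type*} {S : Finset ι} {f : ι → M → ℝ} {Y : ι → VField n M}
    {m : M} (hf : ∀ i ∈ S, ContMDiffAt (𝓡 (2 * n)) 𝓘(ℝ, ℝ) ∞ (f i) m)
    (hY : ∀ i ∈ S, SmoothFieldAt (Y i) m) :
    SmoothFieldAt (∑ i ∈ S, f i • Y i : VField n M) m := by
  have h := ContMDiffAt.sum_section (s := S) (n := ∞) fun i hi => (hf i hi).smul_section (hY i hi)
  refine h.congr_of_eventuallyEq (.of_forall fun x => ?_)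
  simp [Finset.sum_apply]

theorem mlieBracket_sum_smul {ι : Type*} {S : Finset ι} {f : ι → M → ℝ} {Y : ι → VField n M}
    {m : M} (hf : ∀ i ∈ S, ContMDiffAt (𝓡 (2 * n)) 𝓘(ℝ, ℝ) ∞ (f i) m)
    (hY : ∀ i ∈ S, SmoothFieldAt (Y i) m) (Z : VField n M) :
    VectorField.mlieBracket (𝓡 (2 * n)) (∑ i ∈ S, f i • Y i : VField n M) Z m =
      ∑ i ∈ S, (-(dAt (f i) m (Z m)) • Y i m
        + f i m • VectorField.mlieBracket (𝓡 (2 * n)) (Y i) Z m) := by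
  classical
  induction S using Finset.induction_on with
  | empty => simp
  | insert i S hi ih =>
    rw [Finset.sum_insert hi, Finset.sum_insert hi, VectorField.mlieBracket_add_left,
      ih (fun j hj => hf j (by simp [hj])) (fun j hj => hY j (by simp [hj])),
      VectorField.mlieBracket_smul_left ((hf i (by simp)).mdifferentiableAt (by simp))
        (hY i (by simp)).mdifferentiableAt]
    · rfl
    · exact ((hf i (by simp)).smul_section (hY i (by simp))).mdifferentiableAt (by simp)
    · exact (smoothFieldAt_sum_smul (fun j hj => hf j (by simp [hj]))
        (fun j hj => hY j (by simp [hj]))).mdifferentiableAt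

/-- This is `L_{fX} σ = f L_X σ + df ∧ i_X σ`, summed. The wedge term comes from the Leibniz rule
for the brackets, and `dσ` does not enter. -/
theorem lieDeriv_sum_smul (σ : Form n M) {ι : Type*} {S : Finset ι} {f : ι → M → ℝ}
    {X : ι → VField n M} {m : M} (hf : ∀ i ∈ S, ContMDiffAt (𝓡 (2 * n)) 𝓘(ℝ, ℝ) ∞ (f i) m)
    (hX : ∀ i ∈ S, SmoothFieldAt (X i) m) (Y Z : VField n M) :
    lieDeriv σ (∑ i ∈ S, f i • X i : VField n M) Y Z m =
      ∑ i ∈ S, (f i m * lieDeriv σ (X i) Y Z m + dAt (f i) m (Y m) * σ.val m (X i m) (Z m)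
        + dAt (f i) m (Z m) * σ.val m (Y m) (X i m)) := by
  simp only [lieDeriv, mlieBracket_sum_smul hf hX, Finset.sum_apply, Pi.smul_apply', map_sum,
    map_smul, map_add, smul_eq_mul, sum_apply, add_apply, smul_apply]
  rw [← Finset.sum_sub_distrib, ← Finset.sum_sub_distrib]
  refine Finset.sum_congr rfl fun i _ => ?_
  ring

end LieDerivative

end AlmostSymplectic

namespace AlmostSymplectic

/-! ### The momentum map as a fully-Lagrangian toric fibration -/

namespace TorusAction

variable {n : ℕ} {M : Type u} [TopologicalSpace M] [ChartedSpace (E (2 * n)) M]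
  [IsManifold (𝓡 (2 * n)) ∞ M] {σ : Form n M} {Ψ : TorusAction n M} {J : M → E n}

namespace IsMomentumMap

/-- Smooth functions of a momentum map are fully-Hamiltonian. -/
theorem fullyHamiltonianFunction_comp (hJ : Ψ.IsMomentumMap σ J) (hσ : Ψ.IsFullyHamiltonian σ)
    {G : E n → ℝ} (hG : ∀ m, ContDiffAt ℝ ∞ G (J m)) : FullyHamiltonianFunction σ (G ∘ J) := by
  have hGJ : ContMDiff (𝓡 (2 * n)) 𝓘(ℝ, ℝ) ∞ (G ∘ J) := fun m =>
    (hG m).comp_contMDiffAt hJ.1.contMDiffAt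
  set e : Fin n → E n := fun i => EuclideanSpace.single i 1 with he
  set f : Fin n → M → ℝ := fun i m => fderiv ℝ G (J m) (e i) with hf
  have hfd : ∀ i m, ContDiffAt ℝ ∞ (fun a => fderiv ℝ G a (e i)) (J m) := fun i m =>
    ((hG m).fderiv_right (m := ∞) (by simp)).clm_apply contDiffAt_const
  have hfs : ∀ i m, ContMDiffAt (𝓡 (2 * n)) 𝓘(ℝ, ℝ) ∞ (f i) m := fun i m =>
    ContDiffAt.comp_contMDiffAt (f := J) (hfd i m) hJ.1.contMDiffAt
  set Y : Fin n → VField n M := fun i => Ψ.generator (e i) with hY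
  -- By the chain rule, the Hamiltonian field of `G ∘ J` combines the generators with coefficients
  -- `∂ᵢG ∘ J`.
  set X : VField n M := ∑ i, f i • Y i with hX
  have hXs : SmoothField X := fun m =>
    smoothFieldAt_sum_smul (fun i _ => hfs i m) fun i _ => hσ.smoothField (e i) m
  have hsum : ∀ v : E n, v = ∑ i, v i • e i := fun v => by
    conv_lhs => rw [← (EuclideanSpace.basisFun (Fin n) ℝ).sum_repr v]
    simp [he]
  have hYv : ∀ (m : M) (i : Fin n) (v : E (2 * n)),
      σ.val m (Y i m) v = - mder (𝓡 (2 * n)) (𝓡 n) J m v i := fun m i v => by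
    have h1 := hJ.bil_gen m (e i) v
    rw [← generator_eq, Finset.sum_eq_single i (fun j _ hj => by simp [he, hj]) (by simp)] at h1
    simpa [he] using! h1
  have hYv' : ∀ (m : M) (i : Fin n) (v : E (2 * n)),
      σ.val m v (Y i m) = mder (𝓡 (2 * n)) (𝓡 n) J m v i := fun m i v => by
    have h1 := σ.bil_swap m v (Y i m)
    have h2 : σ.bil m (Y i m) v = - mder (𝓡 (2 * n)) (𝓡 n) J m v i := hYv m i v
    rw [h2, neg_neg] at h1
    exact h1
  have hHam : IsHamiltonianOf σ (G ∘ J) X := by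
    intro m v
    have h1 : dAt (G ∘ J) m v = fderiv ℝ G (J m) (mder (𝓡 (2 * n)) (𝓡 n) J m v) := by
      rw [← mder_eq_fderiv]
      exact mder_comp_apply ((hG m).differentiableAt (by simp)).mdifferentiableAt
        (hJ.mdifferentiableAt m) v
    rw [h1, hsum (mder (𝓡 (2 * n)) (𝓡 n) J m v)]
    simp only [hX, Finset.sum_apply, Pi.smul_apply', map_sum, map_smul, sum_apply, smul_apply,
      smul_eq_mul, ← Finset.sum_neg_distrib]
    refine Finset.sum_congr rfl fun i _ => ?_
    have h2 := hYv m i v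
    rw [h2]
    simp only [hf]
    ring
  refine ⟨hGJ, X, hHam, ⟨hXs, G ∘ J, hGJ, hHam⟩, ?_⟩
  intro m Z W hZ hW
  rw [hX, lieDeriv_sum_smul σ (fun i _ => hfs i m) fun i _ => hσ.smoothField (e i) m]
  have h0 : ∀ i, lieDeriv σ (Y i) Z W m = 0 := fun i => (hσ (e i)).2 m Z W hZ hW
  have hdf : ∀ i (v : E (2 * n)), dAt (f i) m v =
      fderiv ℝ (fderiv ℝ G) (J m) (mder (𝓡 (2 * n)) (𝓡 n) J m v) (e i) := fun i v => by
    have hd : DifferentiableAt ℝ (fderiv ℝ G) (J m) :=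
      ((hG m).fderiv_right (m := ∞) (by simp)).differentiableAt (by simp)
    have h1 : HasFDerivAt (fun a => fderiv ℝ G a (e i))
        ((fderiv ℝ (fderiv ℝ G) (J m)).flip (e i)) (J m) := by
      simpa using! hd.hasFDerivAt.clm_apply (hasFDerivAt_const (e i) (J m))
    have h2 : dAt (f i) m v = mder 𝓘(ℝ, E n) 𝓘(ℝ, ℝ) (fun a => fderiv ℝ G a (e i)) (J m)
        (mder (𝓡 (2 * n)) (𝓡 n) J m v) :=
      mder_comp_apply h1.differentiableAt.mdifferentiableAt (hJ.mdifferentiableAt m) v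
    rw [h2, mder_eq_fderiv, h1.fderiv]
    rfl
  -- Since the generators are symmetries, only the wedge terms survive: they sum to `D²G(dJ W, dJ Z)
  -- - D²G(dJ Z, dJ W)`.
  have hsymm : IsSymmSndFDerivAt ℝ G (J m) := (hG m).isSymmSndFDerivAt
    (by rw [minSmoothness_of_isRCLikeNormedField]; exact WithTop.coe_le_coe.2 (le_top : (2 : ℕ∞) ≤ ⊤))
  have hkey : ∀ v w : E (2 * n), ∑ i, dAt (f i) m v * mder (𝓡 (2 * n)) (𝓡 n) J m w i =
      fderiv ℝ (fderiv ℝ G) (J m) (mder (𝓡 (2 * n)) (𝓡 n) J m v)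
        (mder (𝓡 (2 * n)) (𝓡 n) J m w) := fun v w => by
    conv_rhs => rw [hsum (mder (𝓡 (2 * n)) (𝓡 n) J m w)]
    rw [map_sum]
    refine Finset.sum_congr rfl fun i _ => ?_
    have := hdf i v
    rw [this, map_smul, smul_eq_mul, mul_comm]
  have e1 : ∑ i, dAt (f i) m (Z m) * σ.val m (Y i m) (W m)
      = - ∑ i, dAt (f i) m (Z m) * mder (𝓡 (2 * n)) (𝓡 n) J m (W m) i := by
    rw [← Finset.sum_neg_distrib]
    refine Finset.sum_congr rfl fun i _ => ?_
    have := hYv m i (W m)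
    rw [this, mul_neg]
  have e2 : ∑ i, dAt (f i) m (W m) * σ.val m (Z m) (Y i m)
      = ∑ i, dAt (f i) m (W m) * mder (𝓡 (2 * n)) (𝓡 n) J m (Z m) i := by
    refine Finset.sum_congr rfl fun i _ => ?_
    have := hYv' m i (Z m)
    rw [this]
  have e3 := hkey (Z m) (W m)
  have e4 := hkey (W m) (Z m)
  have e5 := hsymm (mder (𝓡 (2 * n)) (𝓡 n) J m (Z m)) (mder (𝓡 (2 * n)) (𝓡 n) J m (W m))
  rw [Finset.sum_add_distrib, Finset.sum_add_distrib, e1, e2]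
  simp only [hY] at h0
  simp only [h0, mul_zero, Finset.sum_const_zero]
  linarith [e3, e4, e5]

theorem contMDiff_ontoImage (hJ : Ψ.IsMomentumMap σ J) (hR : IsOpen (range J)) :
    ContMDiff (𝓡 (2 * n)) (𝓡 n) ∞ (ontoImage J hR) :=
  (ContMDiff.subtypeVal_comp_iff ⟨range J, hR⟩ (ontoImage J hR)).1 hJ.1

variable [T2Space M]

/-- A toric chart built from a section is a local trivialization with typical fiber the torus. -/
theorem isSmoothFibration (hJ : Ψ.IsMomentumMap σ J) (hΨ : Ψ.IsFree)
    (hσ : Ψ.IsFullyHamiltonian σ) (hconn : ∀ a : E n, IsPreconnected (J ⁻¹' {a}))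
    (hR : IsOpen (range J)) : IsSmoothFibration (n := n) (k := n) (ontoImage J hR) := by
  refine ⟨hJ.contMDiff_ontoImage hR, ?_⟩
  rintro ⟨_, m, rfl⟩
  obtain ⟨s, A, hA, hmA, -, hs, hJs⟩ := hJ.exists_section hΨ hσ m
  obtain ⟨c, hsrc, hset, hact, hinv⟩ := hJ.exists_toricChart hΨ hσ hconn hJs hA hs
  have hcact : ∀ x, (c.toPartialEquiv x).1 = J x := hact
  have htgt : c.target = A ×ˢ univ := by rw [c.target_eq, hset]
  refine ⟨Subtype.val ⁻¹' A, hA.preimage continuous_subtype_val, hmA, TorusModel n, inferInstance,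
    inferInstance, inferInstance, Torus n, inferInstance, inferInstance, inferInstance,
    { toFun := fun x => (ontoImage J hR x, c.angle x)
      invFun := fun p => Ψ.act p.2 (s p.1)
      source := J ⁻¹' A
      target := (Subtype.val ⁻¹' A) ×ˢ univ
      map_source' := fun x hx => ⟨hx, trivial⟩
      map_target' := ?_
      left_inv' := ?_
      right_inv' := ?_
      open_source := hA.preimage hJ.1.continuous
      open_target := (hA.preimage continuous_subtype_val).prod isOpen_univ
      contMDiffOn_toFun := ?_
      contMDiffOn_invFun := ?_ }, rfl, rfl, fun _ _ => rfl⟩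
  · rintro ⟨b, β⟩ ⟨hb, -⟩
    rw [mem_preimage, hJ.act_eq, hJs _ hb]
    exact hb
  · intro x hx
    have h1 := c.left_inv (x := x) (by rw [hsrc]; exact hx)
    have h2 := hinv (c.toPartialEquiv x)
    rw [hcact] at h2
    exact h2.symm.trans h1
  · rintro ⟨b, β⟩ ⟨hb, -⟩
    have hb' : (b : E n) ∈ A := hb
    have h1 := c.right_inv (x := ((b : E n), β)) (by rw [htgt]; exact ⟨hb', trivial⟩)
    have h2 : c.toPartialEquiv.symm ((b : E n), β) = Ψ.act β (s b) := hinv _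
    rw [h2] at h1
    have h3 : c.angle (Ψ.act β (s b)) = β := congrArg Prod.snd h1
    refine Prod.ext (Subtype.ext ?_) h3
    exact (hJ.act_eq _ _).trans (hJs _ hb')
  · intro x hx
    refine ContMDiffAt.contMDiffWithinAt ?_
    refine (hJ.contMDiff_ontoImage hR).contMDiffAt.prodMk (contMDiffAt_torus fun i => ?_)
    exact (c.smooth_angle i).contMDiffAt (c.isOpen_source.mem_nhds (by rw [hsrc]; exact hx))
  · have h1 : ContMDiffOn ((𝓡 n).prod 𝓘(ℝ, TorusModel n)) (𝓡 (2 * n)) ∞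
        (fun p : (⟨range J, hR⟩ : TopologicalSpace.Opens (E n)) × Torus n => s p.1)
        ((Subtype.val ⁻¹' A) ×ˢ univ) :=
      hs.comp ((contMDiff_subtype_val.comp contMDiff_fst).contMDiffOn) fun p hp => hp.1
    exact Ψ.contMDiff_act.comp_contMDiffOn (contMDiff_snd.contMDiffOn.prodMk h1)

/-- Since `dJ` is onto and factors through the derivative of the inclusion of `J(M)`, that
derivative is onto between spaces of equal dimension, hence injective. -/
theorem ker_mfderiv_ontoImage (hJ : Ψ.IsMomentumMap σ J) (hΨ : Ψ.IsFree)
    (hσ : Ψ.IsFullyHamiltonian σ) (hR : IsOpen (range J)) (m : M) :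
    (mder (𝓡 (2 * n)) (𝓡 n) (ontoImage J hR) m).ker
      = (mder (𝓡 (2 * n)) (𝓡 n) J m).ker := by
  have h1 : mder (𝓡 (2 * n)) (𝓡 n) J m = (mder (𝓡 n) (𝓡 n)
      (Subtype.val : (⟨range J, hR⟩ : TopologicalSpace.Opens (E n)) → E n) (ontoImage J hR m)).comp
      (mder (𝓡 (2 * n)) (𝓡 n) (ontoImage J hR) m) :=
    mder_comp (contMDiff_subtype_val.contMDiffAt.mdifferentiableAt (n := ∞) (by simp))
      ((hJ.contMDiff_ontoImage hR).contMDiffAt.mdifferentiableAt (by simp))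
  have h2 := hJ.mder_surjective hΨ hσ m
  rw [h1, ContinuousLinearMap.coe_comp] at h2
  have h3 := (LinearMap.injective_iff_surjective_of_finrank_eq_finrank rfl (f :=
    ContinuousLinearMap.toLinearMap (mder (𝓡 n) (𝓡 n)
      (Subtype.val : (⟨range J, hR⟩ : TopologicalSpace.Opens (E n)) → E n)
      (ontoImage J hR m)))).2 h2.of_comp
  ext v
  rw [h1]
  exact ⟨fun h => by
    have h' : mder (𝓡 (2 * n)) (𝓡 n) (ontoImage J hR) m v = 0 := h
    show mder (𝓡 n) (𝓡 n) _ _ (mder (𝓡 (2 * n)) (𝓡 n) (ontoImage J hR) m v) = 0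
    rw [h', map_zero], fun h => h3 (h.trans (map_zero _).symm)⟩

theorem isFullyLagrangianToricFibration (hJ : Ψ.IsMomentumMap σ J) (hΨ : Ψ.IsFree)
    (hσ : Ψ.IsFullyHamiltonian σ) (hconn : ∀ a : E n, IsPreconnected (J ⁻¹' {a}))
    (hR : IsOpen (range J)) :
    IsFullyLagrangianToricFibration (k := n) σ (ontoImage J hR) := by
  have hfib : ∀ m, ontoImage J hR ⁻¹' {ontoImage J hR m} = J ⁻¹' {J m} := fun m => by
    ext x
    simp [ontoImage]
  refine ⟨hJ.isSmoothFibration hΨ hσ hconn hR, ?_, ?_, ?_, ?_⟩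
  · rintro ⟨_, m, rfl⟩
    have h1 : ontoImage J hR ⁻¹' {⟨J m, m, rfl⟩} = range fun β => Ψ.act β m := by
      refine (hfib m).trans ?_
      ext x
      exact ⟨fun hx => hJ.exists_act_eq hΨ hσ hconn hx, by
        rintro ⟨β, rfl⟩
        exact hJ.act_eq β m⟩
    rw [h1]
    exact isCompact_range (Ψ.continuous_act_left m)
  · rintro ⟨_, m, rfl⟩
    exact ⟨⟨m, rfl⟩, (hfib m).symm ▸ hconn (J m)⟩
  · intro m
    have hker : (mder (𝓡 (2 * n)) (𝓡 n) (ontoImage J hR) m).ker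
      = (mder (𝓡 (2 * n)) (𝓡 n) J m).ker := hJ.ker_mfderiv_ontoImage hΨ hσ hR m
    constructor
    · intro v hv w hw
      have hv' : (v : E (2 * n)) ∈ (mder (𝓡 (2 * n)) (𝓡 n) (ontoImage J hR) m).ker := hv
      have hw' : (w : E (2 * n)) ∈ (mder (𝓡 (2 * n)) (𝓡 n) (ontoImage J hR) m).ker := hw
      rw [hker] at hv' hw'
      obtain ⟨ξ, rfl⟩ := hJ.exists_gen_eq hΨ hσ m hv'
      refine (hJ.bil_gen m ξ w).trans ?_
      have hw2 : mder (𝓡 (2 * n)) (𝓡 n) J m w = 0 := hw'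
      simp [hw2]
    · exact (congrArg (fun W : Submodule ℝ (E (2 * n)) => Module.finrank ℝ W) hker).trans
        (hJ.finrank_ker hΨ hσ m)
  · intro g hg
    classical
    -- Extension by zero may be discontinuous at the boundary, but smoothness is needed only at
    -- points of the open image.
    set G : E n → ℝ := fun a => if h : a ∈ range J then g ⟨a, h⟩ else 0 with hGdef
    have hcomp : g ∘ ontoImage J hR = G ∘ J := by
      funext m
      simp [hGdef, ontoImage]
    rw [hcomp]
    refine hJ.fullyHamiltonianFunction_comp hσ fun m => ?_
    have h1 : ContMDiffAt (𝓡 n) 𝓘(ℝ, ℝ) ∞ G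
        ((ontoImage J hR m : (⟨range J, hR⟩ : TopologicalSpace.Opens (E n))) : E n) := by
      rw [← contMDiffAt_subtype_iff]
      refine hg.contMDiffAt.congr_of_eventuallyEq (.of_forall fun b => ?_)
      have hb : (b : E n) ∈ range J := b.2
      simp only [hGdef, dif_pos hb]
    exact contMDiffAt_iff_contDiffAt.1 h1

end IsMomentumMap

end TorusAction

end AlmostSymplectic

namespace AlmostSymplectic

/-! ### Hamiltonian fields of the actions in action-angle charts -/

variable {n k : ℕ} {M : Type u} [TopologicalSpace M] [ChartedSpace (E (2 * n)) M]

namespace ToricChart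

variable (c : ToricChart n M) {m : M} {p : E n × E n}

theorem action_mem (hm : m ∈ c.source) : c.action m ∈ c.actionSet := by
  have h := c.map_source hm
  rw [c.target_eq] at h
  exact h.1

theorem invFun_mem_source {q : E n × Torus n} (hq : q.1 ∈ c.actionSet) :
    c.invFun q ∈ c.source :=
  c.map_target (by rw [c.target_eq]; exact ⟨hq, trivial⟩)

theorem toFun_invFun {q : E n × Torus n} (hq : q.1 ∈ c.actionSet) :
    c.toFun (c.invFun q) = q :=
  c.right_inv (by rw [c.target_eq]; exact ⟨hq, trivial⟩)

theorem action_invFun {q : E n × Torus n} (hq : q.1 ∈ c.actionSet) :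
    c.action (c.invFun q) = q.1 := congrArg Prod.fst (c.toFun_invFun hq)

theorem angle_invFun {q : E n × Torus n} (hq : q.1 ∈ c.actionSet) :
    c.angle (c.invFun q) = q.2 := congrArg Prod.snd (c.toFun_invFun hq)

theorem param_action (hm : m ∈ c.source) {t : E n} (ht : torusExp t = c.angle m) :
    c.param (c.action m, t) = m := by
  rw [param, ht]
  exact c.left_inv hm

theorem eventually_mem_actionSet (hp : p.1 ∈ c.actionSet) : ∀ᶠ q in 𝓝 p, q.1 ∈ c.actionSet :=
  (c.isOpen_actionSet.preimage continuous_fst).mem_nhds hp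

theorem contMDiffAt_param (hp : p.1 ∈ c.actionSet) :
    ContMDiffAt 𝓘(ℝ, E n × E n) (𝓡 (2 * n)) ∞ c.param p :=
  c.smooth_symm.contMDiffAt
    ((c.isOpen_actionSet.prod isOpen_univ).mem_nhds ⟨hp, trivial⟩)

theorem mdifferentiableAt_param (hp : p.1 ∈ c.actionSet) :
    MDifferentiableAt 𝓘(ℝ, E n × E n) (𝓡 (2 * n)) c.param p :=
  (c.contMDiffAt_param hp).mdifferentiableAt (by simp)

theorem contMDiffAt_action (hm : m ∈ c.source) :
    ContMDiffAt (𝓡 (2 * n)) (𝓡 n) ∞ c.action m :=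
  c.smooth_action.contMDiffAt (c.isOpen_source.mem_nhds hm)

end ToricChart

variable [IsManifold (𝓡 (2 * n)) ∞ M] {B : Type v} {σ : Form n M} {π : M → B}
  {c c' : ToricChart n M} {F : M → E n} {X : VField n M} {ξ : E n}

/-- The matrix `A` drops out, which is why Hamiltonian fields of actions look as in the symplectic
case. -/
theorem modelForm_snd (A : Matrix (Fin n) (Fin n) ℝ) (ξ : E n) (v : E n × E n) :
    modelForm A (0, ξ) v = - ∑ i, ξ i * v.1 i := by
  simp [modelForm, mul_comm]

/-- Pairing with angle vectors kills the action part; the `A` terms then disappear, and pairing with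
action vectors kills the rest. -/
theorem eq_zero_of_modelForm {A : Matrix (Fin n) (Fin n) ℝ} {u : E n × E n}
    (h : ∀ v, modelForm A u v = 0) : u = 0 := by
  have h1 : u.1 = 0 := by
    ext i
    have := h (0, EuclideanSpace.single i 1)
    simpa [modelForm] using this
  obtain ⟨a, b⟩ := u
  obtain rfl : a = 0 := h1
  have h2 : b = 0 := by
    ext i
    have := h (EuclideanSpace.single i 1, 0)
    simpa [modelForm] using this
  rw [h2]
  rfl

namespace IsActionAngleChart

theorem mder_param_bijective (hc : IsActionAngleChart σ π c) {p : E n × E n}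
    (hp : p.1 ∈ c.actionSet) :
    Function.Bijective (mder 𝓘(ℝ, E n × E n) (𝓡 (2 * n)) c.param p) := by
  obtain ⟨A, -, -, h⟩ := hc.form
  have hinj : Function.Injective (mder 𝓘(ℝ, E n × E n) (𝓡 (2 * n)) c.param p) := by
    rw [injective_iff_map_eq_zero]
    intro u hu
    refine eq_zero_of_modelForm (A := A p.1) fun v => ?_
    have h1 : σ.bil (c.param p) (mder 𝓘(ℝ, E n × E n) (𝓡 (2 * n)) c.param p u)
      (mder 𝓘(ℝ, E n × E n) (𝓡 (2 * n)) c.param p v) = modelForm (A p.1) u v := h p.1 hp p.2 u v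
    rw [← h1, hu, map_zero, zero_apply]
  exact ⟨hinj, (LinearMap.injective_iff_surjective_of_finrank_eq_finrank
    (f := (mder 𝓘(ℝ, E n × E n) (𝓡 (2 * n)) c.param p).toLinearMap)
    (by simp [Module.finrank_prod, two_mul])).1 hinj⟩

/-- The Hamiltonian vector fields of the actions are the coordinate vector fields of the angles. -/
theorem hamiltonian_eq (hc : IsActionAngleChart σ π c) (hF : ∀ m ∈ c.source, F m = c.action m)
    (hX : IsHamiltonianOf σ (fun m => ∑ i, ξ i * F m i) X) {p : E n × E n}
    (hp : p.1 ∈ c.actionSet) :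
    X (c.param p) = mder 𝓘(ℝ, E n × E n) (𝓡 (2 * n)) c.param p (0, ξ) := by
  obtain ⟨A, -, -, h⟩ := hc.form
  refine σ.eq_of_forall (x := c.param p) fun z => ?_
  obtain ⟨v, rfl⟩ := (hc.mder_param_bijective hp).2 z
  have h1 : σ.bil (c.param p) (mder 𝓘(ℝ, E n × E n) (𝓡 (2 * n)) c.param p (0, ξ))
    (mder 𝓘(ℝ, E n × E n) (𝓡 (2 * n)) c.param p v) = modelForm (A p.1) (0, ξ) v :=
    h p.1 hp p.2 _ v
  rw [h1, modelForm_snd]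
  refine (hX _ _).trans (congrArg Neg.neg ?_)
  have hm : c.param p ∈ c.source := c.invFun_mem_source hp
  have hFs : MDifferentiableAt (𝓡 (2 * n)) 𝓘(ℝ, ℝ) (fun m => ∑ i, ξ i * F m i) (c.param p) := by
    refine (contMDiffAt_inner ((c.contMDiffAt_action hm).congr_of_eventuallyEq ?_)
      ξ).mdifferentiableAt (by simp)
    filter_upwards [c.isOpen_source.mem_nhds hm] with x hx using hF x hx
  have h2 : (fun q => ∑ i, ξ i * F (c.param q) i) =ᶠ[𝓝 p] fun q => ∑ i, ξ i * q.1 i := by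
    filter_upwards [c.eventually_mem_actionSet hp] with q hq
    rw [ToricChart.param, hF _ (c.invFun_mem_source (q := (q.1, torusExp q.2)) hq),
      c.action_invFun (q := (q.1, torusExp q.2)) hq]
  have h3 : HasFDerivAt (fun q : E n × E n => ∑ i, ξ i * q.1 i)
      (∑ i, ξ i • (EuclideanSpace.proj i : E n →L[ℝ] ℝ).comp (ContinuousLinearMap.fst ℝ _ _)) p :=
    HasFDerivAt.fun_sum fun i _ => (((EuclideanSpace.proj i : E n →L[ℝ] ℝ).comp
      (ContinuousLinearMap.fst ℝ (E n) (E n))).hasFDerivAt).const_mul _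
  have h4 := mder_comp_apply hFs (c.mdifferentiableAt_param hp) v
  refine h4.symm.trans ?_
  rw [mder_congr h2, mder_eq_fderiv, h3.fderiv]
  simp

theorem isMIntegralCurve_param (hc : IsActionAngleChart σ π c)
    (hF : ∀ m ∈ c.source, F m = c.action m)
    (hX : IsHamiltonianOf σ (fun m => ∑ i, ξ i * F m i) X) {a : E n} (ha : a ∈ c.actionSet)
    (t : E n) : IsMIntegralCurve (fun s : ℝ => c.param (a, t + s • ξ)) X := by
  refine isMIntegralCurve_iff.2 fun s => ?_
  have h := mder_comp_line (g := c.param) ((a, t) : E n × E n) (0, ξ) s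
    (c.mdifferentiableAt_param (by simpa using ha))
  simp only [Prod.smul_mk, smul_zero, Prod.mk_add_mk, add_zero] at h
  exact ⟨h.1, h.2.trans (hc.hamiltonian_eq hF hX (p := (a, t + s • ξ)) ha).symm⟩

variable [T2Space M]

/-- Two action-angle charts with the same actions have the same angle translations. -/
theorem invFun_translate_eq (hc : IsActionAngleChart σ π c) (hc' : IsActionAngleChart σ π c')
    (hF : ∀ m ∈ c.source, F m = c.action m) (hF' : ∀ m ∈ c'.source, F m = c'.action m)
    (hX : ∀ ξ : E n, ∃ X : VField n M, SmoothField X ∧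
      IsHamiltonianOf σ (fun m => ∑ i, ξ i * F m i) X)
    {m : M} (hm : m ∈ c.source) (hm' : m ∈ c'.source) (β : Torus n) :
    c.invFun (c.action m, c.angle m * β) = c'.invFun (c'.action m, c'.angle m * β) := by
  obtain ⟨t, ht⟩ := torusExp_surjective (c.angle m)
  obtain ⟨t', ht'⟩ := torusExp_surjective (c'.angle m)
  obtain ⟨ξ, rfl⟩ := torusExp_surjective β
  obtain ⟨X, hXs, hX⟩ := hX ξ
  -- The two coordinate lines are integral curves of one field `X` through `m`; they are compared at
  -- time `1`.
  have h := congrFun (isMIntegralCurve_Ioo_eq_of_contMDiff_boundaryless (t₀ := 0)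
    ((show ContMDiff _ _ ∞ _ from hXs).of_le (by simp))
    (hc.isMIntegralCurve_param hF hX (c.action_mem hm) t)
    (hc'.isMIntegralCurve_param hF' hX (c'.action_mem hm') t')
    (by simp only [zero_smul, add_zero, c.param_action hm ht, c'.param_action hm' ht'])) 1
  simpa only [ToricChart.param, one_smul, torusExp_add, ht, ht'] using h

end IsActionAngleChart

end AlmostSymplectic

namespace AlmostSymplectic

/-! ### Gluing the angle translations into a torus action -/

variable {n k : ℕ} {M : Type u} [TopologicalSpace M] [ChartedSpace (E (2 * n)) M]

theorem ToricChart.actsByTranslation_of_eq {Ψ : TorusAction n M} {c : ToricChart n M}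
    (h : ∀ m ∈ c.source, ∀ β, Ψ.act β m = c.invFun (c.action m, c.angle m * β)) :
    Ψ.ActsByTranslation c := fun m hm β => by
  rw [h m hm β]
  exact ⟨c.invFun_mem_source (c.action_mem hm), c.action_invFun (c.action_mem hm),
    c.angle_invFun (c.action_mem hm)⟩

variable [IsManifold (𝓡 (2 * n)) ∞ M] {B : Type v} {σ : Form n M} {π : M → B}
  {P : Set (ToricChart n M)}

namespace IsAtlasWithGlobalActions

theorem contMDiff_globalActionMap (hP : IsAtlasWithGlobalActions σ π P) :
    ContMDiff (𝓡 (2 * n)) (𝓡 n) ∞ (globalActionMap P) := fun m => by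
  obtain ⟨c, hc, hm⟩ := hP.cover m
  refine (c.contMDiffAt_action hm).congr_of_eventuallyEq ?_
  filter_upwards [c.isOpen_source.mem_nhds hm] with x hx using hP.globalActionMap_eq hc hx

theorem globalActionMap_eq_of_eq (hP : IsAtlasWithGlobalActions σ π P) {m m' : M}
    (h : π m' = π m) : globalActionMap P m' = globalActionMap P m := by
  obtain ⟨c, hc, hm⟩ := hP.cover m
  obtain ⟨hm', h'⟩ := ((hP.actionAngle c hc).fibers m hm m').1 h
  rw [hP.globalActionMap_eq hc hm, hP.globalActionMap_eq hc hm', h']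

/-- The local translations of the angles fit together to an action of the torus. -/
theorem exists_torusAction [T2Space M] (hP : IsAtlasWithGlobalActions σ π P)
    (hX : ∀ ξ : E n, ∃ X : VField n M, SmoothField X ∧
      IsHamiltonianOf σ (fun m => ∑ i, ξ i * globalActionMap P m i) X) :
    ∃ Ψ : TorusAction n M, ∀ c ∈ P, ∀ m ∈ c.source, ∀ β,
      Ψ.act β m = c.invFun (c.action m, c.angle m * β) := by
  choose d hdP hd using hP.cover
  set act : Torus n → M → M := fun β m => (d m).invFun ((d m).action m, (d m).angle m * β)
    with hact
  have key : ∀ c ∈ P, ∀ m ∈ c.source, ∀ β, act β m = c.invFun (c.action m, c.angle m * β) :=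
    fun c hc m hm β => (hP.actionAngle _ (hdP m)).invFun_translate_eq (hP.actionAngle c hc)
      (fun _ hx => hP.globalActionMap_eq (hdP m) hx) (fun _ hx => hP.globalActionMap_eq hc hx)
      hX (hd m) hm β
  refine ⟨⟨act, fun m => ?_, fun β γ m => ?_, ?_⟩, key⟩
  · rw [hact]
    simp only [mul_one]
    exact (d m).left_inv (hd m)
  -- The point `act γ m` stays in the chart chosen at `m`, so by `key` both translations can be
  -- computed there.
  · have ha := (d m).action_mem (hd m)
    have h1 : act γ m = (d m).invFun ((d m).action m, (d m).angle m * γ) := rfl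
    have h2 : act γ m ∈ (d m).source := (d m).invFun_mem_source ha
    rw [key _ (hdP m) _ h2, h1, (d m).action_invFun (q := ((d m).action m, (d m).angle m * γ)) ha,
      (d m).angle_invFun (q := ((d m).action m, (d m).angle m * γ)) ha, mul_assoc, mul_comm γ β]
  · rintro ⟨t, m⟩
    have hm := hd m
    set c := d m with hc
    obtain ⟨t₀, ht₀⟩ := torusExp_surjective (c.angle m)
    obtain ⟨θ, hθ0, hθ, hθe⟩ := exists_torus_lift (I := 𝓡 (2 * n)) (f := c.angle) (x := m)
      (fun i => (c.smooth_angle i).contMDiffAt (c.isOpen_source.mem_nhds hm)) t₀ ht₀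
    have h1 : ContMDiffAt ((𝓡 n).prod (𝓡 (2 * n))) (𝓡 n) ∞
        (fun p : E n × M => θ p.2 + p.1) (t, m) :=
      (ContMDiffAt.comp (t, m) (f := Prod.snd) hθ contMDiffAt_snd).add contMDiffAt_fst
    have h2 : ContMDiffAt ((𝓡 n).prod (𝓡 (2 * n))) (𝓡 n) ∞
        (fun p : E n × M => c.action p.2) (t, m) :=
      ContMDiffAt.comp (t, m) (f := Prod.snd) (c.contMDiffAt_action hm) contMDiffAt_snd
    have h3 : ContMDiffAt ((𝓡 n).prod (𝓡 (2 * n))) (𝓡 (2 * n)) ∞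
        (fun p : E n × M => c.param (c.action p.2, θ p.2 + p.1)) (t, m) :=
      ContMDiffAt.comp (g := c.param) (f := fun p : E n × M => (c.action p.2, θ p.2 + p.1)) (t, m)
        (c.contMDiffAt_param (p := (c.action m, θ m + t)) (c.action_mem hm)) (h2.prodMk_space h1)
    refine h3.congr_of_eventuallyEq ?_
    filter_upwards [(c.isOpen_source.preimage continuous_snd).mem_nhds hm] with p hp
    rw [key c (hdP m) _ hp, ToricChart.param, torusExp_add, hθe]

theorem generator_eq (hP : IsAtlasWithGlobalActions σ π P) {Ψ : TorusAction n M}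
    (hΨ : ∀ c ∈ P, ∀ m ∈ c.source, ∀ β, Ψ.act β m = c.invFun (c.action m, c.angle m * β))
    {ξ : E n} {X : VField n M}
    (hX : IsHamiltonianOf σ (fun m => ∑ i, ξ i * globalActionMap P m i) X) :
    Ψ.generator ξ = X := by
  funext m
  obtain ⟨c, hc, hm⟩ := hP.cover m
  obtain ⟨t, ht⟩ := torusExp_surjective (c.angle m)
  have h := ((isMIntegralCurve_iff.1 ((hP.actionAngle c hc).isMIntegralCurve_param
    (fun _ hx => hP.globalActionMap_eq hc hx) hX (c.action_mem hm) t)) 0).2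
  have h1 : (fun s : ℝ => c.param (c.action m, t + s • ξ))
      = fun s : ℝ => Ψ.act (torusExp (s • ξ)) m := by
    funext s
    rw [hΨ c hc m hm, ToricChart.param, torusExp_add, ht]
  have h2 : c.param (c.action m, t + (0 : ℝ) • ξ) = m := by
    rw [zero_smul, add_zero, c.param_action hm ht]
  rw [h1] at h
  beta_reduce at h
  have h3 : (X (c.param (c.action m, t + (0 : ℝ) • ξ)) : E (2 * n)) = (X m : E (2 * n)) :=
    congrArg (fun x => (X x : E (2 * n))) h2
  exact h.trans h3

theorem isFree (hP : IsAtlasWithGlobalActions σ π P) {Ψ : TorusAction n M}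
    (hΨ : ∀ c ∈ P, Ψ.ActsByTranslation c) : Ψ.IsFree := fun β m h => by
  obtain ⟨c, hc, hm⟩ := hP.cover m
  have h1 := (hΨ c hc m hm β).2.2
  rw [h] at h1
  exact (mul_eq_left.1 h1.symm)

variable [TopologicalSpace B] [ChartedSpace (E k) B]

/-- The quotient function uses an arbitrary point of each fiber. Since `f` is constant on fibers,
that choice may be replaced locally by a smooth section with constant fiber component in a
trivialization. -/
theorem exists_basic_eq (hπ : IsFullyLagrangianToricFibration (k := k) σ π)
    {f : M → ℝ} (hf : ContMDiff (𝓡 (2 * n)) 𝓘(ℝ, ℝ) ∞ f)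
    (h : ∀ m m', π m' = π m → f m' = f m) :
    ∃ g : B → ℝ, ContMDiff (𝓡 k) 𝓘(ℝ, ℝ) ∞ g ∧ g ∘ π = f := by
  choose s hs using fun b => (hπ.connected_fibers b).nonempty
  have hs' : ∀ b, π (s b) = b := hs
  refine ⟨fun b => f (s b), fun b => ?_, funext fun m => h _ _ (hs' (π m))⟩
  obtain ⟨U, hU, hb, V, _, _, _, F, _, _, _, Φ, hsrc, htgt, hΦ⟩ := hπ.fibration.2 b
  have hsb : s b ∈ Φ.source := by
    rw [hsrc, mem_preimage, hs']
    exact hb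
  have hmem : ∀ b' ∈ U, (b', (Φ (s b)).2) ∈ Φ.target := fun b' hb' => by
    rw [htgt]
    exact ⟨hb', trivial⟩
  have h1 : ContMDiffAt (𝓡 k) (𝓡 (2 * n)) ∞ (fun b' => Φ.symm (b', (Φ (s b)).2)) b :=
    ContMDiffAt.comp (I' := (𝓡 k).prod 𝓘(ℝ, V)) b
      (Φ.symm.contMDiffOn.contMDiffAt (Φ.open_target.mem_nhds (hmem b hb)))
      (contMDiffAt_id.prodMk contMDiffAt_const)
  refine (hf.contMDiffAt.comp b h1).congr_of_eventuallyEq ?_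
  filter_upwards [hU.mem_nhds hb] with b' hb'
  refine h _ _ ((hs' b').trans ?_)
  have h2 := hΦ _ (Φ.map_target (hmem b' hb'))
  have h3 : Φ (Φ.symm (b', (Φ (s b)).2)) = (b', (Φ (s b)).2) := Φ.right_inv (hmem b' hb')
  exact (congrArg Prod.fst h3).symm.trans h2

/-- The global actions of a fully-Lagrangian toric fibration are the momentum map of a free
fully-Hamiltonian action of the torus, which translates the angles. -/
theorem exists_action [T2Space M] (hP : IsAtlasWithGlobalActions σ π P)
    (hπ : IsFullyLagrangianToricFibration (k := k) σ π) :
    ∃ Ψ : TorusAction n M, Ψ.IsFree ∧ Ψ.IsFullyHamiltonian σ ∧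
      Ψ.IsMomentumMap σ (globalActionMap P) ∧ ∀ c ∈ P, Ψ.ActsByTranslation c := by
  have hX : ∀ ξ : E n, ∃ X : VField n M, FullyHamiltonian σ X ∧
      IsHamiltonianOf σ (fun m => ∑ i, ξ i * globalActionMap P m i) X := fun ξ => by
    obtain ⟨g, hg, hgf⟩ := exists_basic_eq hπ
      (f := fun m => ∑ i, ξ i * globalActionMap P m i)
      (fun m => contMDiffAt_inner (hP.contMDiff_globalActionMap m) ξ)
      fun m m' h => by simp only [hP.globalActionMap_eq_of_eq h]
    obtain ⟨-, X, hX1, hX2⟩ := hπ.basic_functions g hg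
    rw [hgf] at hX1
    exact ⟨X, hX2, hX1⟩
  obtain ⟨Ψ, hΨ⟩ := hP.exists_torusAction fun ξ => by
    obtain ⟨X, h1, h2⟩ := hX ξ
    exact ⟨X, h1.1.1, h2⟩
  have htr : ∀ c ∈ P, Ψ.ActsByTranslation c := fun c hc =>
    ToricChart.actsByTranslation_of_eq (hΨ c hc)
  refine ⟨Ψ, hP.isFree htr, fun ξ => ?_, ⟨hP.contMDiff_globalActionMap, fun ξ => ?_⟩, htr⟩
  · obtain ⟨X, h1, h2⟩ := hX ξ
    rw [hP.generator_eq hΨ h2]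
    exact h1
  · obtain ⟨X, h1, h2⟩ := hX ξ
    rw [hP.generator_eq hΨ h2]
    exact h2

end IsAtlasWithGlobalActions

end AlmostSymplectic

namespace AlmostSymplectic

/-! ### Linear maps preserving the period lattice -/

section Lattice

variable {n : ℕ}

/-- The endomorphism of the Lie algebra of the torus given by an integer matrix. -/
noncomputable def latticeMap (Z : Matrix (Fin n) (Fin n) ℤ) (ξ : E n) : E n :=
  WithLp.toLp 2 fun i => ∑ j, (Z i j : ℝ) * ξ j

theorem latticeMap_apply (Z : Matrix (Fin n) (Fin n) ℤ) (ξ : E n) (i : Fin n) :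
    latticeMap Z ξ i = ∑ j, (Z i j : ℝ) * ξ j := rfl

theorem latticeMap_single (Z : Matrix (Fin n) (Fin n) ℤ) (i j : Fin n) :
    latticeMap Z (EuclideanSpace.single j 1) i = Z i j := by
  simp [latticeMap_apply]

theorem latticeMap_mul (Z W : Matrix (Fin n) (Fin n) ℤ) (ξ : E n) :
    latticeMap (Z * W) ξ = latticeMap Z (latticeMap W ξ) := by
  ext i
  simp only [latticeMap_apply, Matrix.mul_apply, Int.cast_sum, Int.cast_mul, Finset.sum_mul,
    Finset.mul_sum]
  rw [Finset.sum_comm]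
  simp only [mul_assoc]

theorem latticeMap_one (ξ : E n) : latticeMap 1 ξ = ξ := by
  ext i
  simp [latticeMap_apply, Matrix.one_apply]

theorem latticeMap_injective :
    Function.Injective (latticeMap : Matrix (Fin n) (Fin n) ℤ → E n → E n) := fun Z W h => by
  ext i j
  have := congrArg (fun f => f (EuclideanSpace.single j 1) i) h
  simpa [latticeMap_single] using this

theorem torusExp_latticeMap (Z : Matrix (Fin n) (Fin n) ℤ) (ξ : E n) (i : Fin n) :
    torusExp (latticeMap Z ξ) i = ∏ j, torusExp ξ j ^ Z i j := by
  have h1 : ∀ (s : Finset (Fin n)) (f : Fin n → ℝ),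
      Circle.exp (∑ j ∈ s, f j) = ∏ j ∈ s, Circle.exp (f j) := fun s f => by
    classical
    induction s using Finset.induction_on with
    | empty => simp
    | insert j s hj ih => rw [Finset.sum_insert hj, Finset.prod_insert hj, Circle.exp_add, ih]
  rw [torusExp, latticeMap_apply, h1]
  refine Finset.prod_congr rfl fun j _ => ?_
  rw [← zsmul_eq_mul, Circle.exp_zsmul]
  rfl

/-- A linear map which takes periods of the torus to periods is given by an integer matrix. -/
theorem exists_eq_latticeMap (L : E n →ₗ[ℝ] E n) (h : ∀ t, torusExp t = 1 → torusExp (L t) = 1) :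
    ∃ Z, ∀ ξ, L ξ = latticeMap Z ξ := by
  have h1 : ∀ j, ∃ k : Fin n → ℤ, ∀ i, L (EuclideanSpace.single j 1) i = k i := fun j => by
    obtain ⟨k, hk⟩ := torusExp_eq_one_iff.1 (h (EuclideanSpace.single j (2 * Real.pi))
      (torusExp_eq_one_iff.2 ⟨Pi.single j 1, fun i => by
        by_cases hi : i = j
        · subst hi; simp
        · simp [hi]⟩))
    refine ⟨k, fun i => ?_⟩
    have h2 : (EuclideanSpace.single j (2 * Real.pi) : E n)
        = (2 * Real.pi) • EuclideanSpace.single j 1 := by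
      ext i; simp
    have h3 := hk i
    rw [h2, map_smul, PiLp.smul_apply, smul_eq_mul, mul_comm] at h3
    exact mul_right_cancel₀ (by positivity) h3
  choose k hk using h1
  refine ⟨Matrix.of fun i j => k j i, fun ξ => ?_⟩
  have h2 : ξ = ∑ j, ξ j • EuclideanSpace.single j (1 : ℝ) := by
    conv_lhs => rw [← (EuclideanSpace.basisFun (Fin n) ℝ).sum_repr ξ]
    simp
  ext i
  conv_lhs => rw [h2]
  simp [latticeMap_apply, hk, mul_comm]

/-- A linear isomorphism which preserves the periods of the torus is unimodular. -/
theorem exists_eq_latticeMap_of_injective (L : E n →ₗ[ℝ] E n) (hL : Function.Injective L)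
    (h : ∀ t, torusExp (L t) = 1 ↔ torusExp t = 1) :
    ∃ Z : GL (Fin n) ℤ, ∀ ξ, L ξ = latticeMap Z.val ξ := by
  set L' := LinearEquiv.ofInjectiveEndo L hL with hL'
  have hLL : ∀ t, L (L'.symm t) = t := fun t => L'.apply_symm_apply t
  obtain ⟨Z, hZ⟩ := exists_eq_latticeMap L fun t => (h t).2
  -- The inverse preserves periods too, so it supplies the integer inverse matrix.
  obtain ⟨W, hW⟩ := exists_eq_latticeMap L'.symm.toLinearMap fun t ht =>
    (h _).1 ((congrArg torusExp (hLL t)).trans ht)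
  have hZW : Z * W = 1 := latticeMap_injective <| funext fun ξ => by
    rw [latticeMap_mul, ← hW, ← hZ, latticeMap_one]
    exact hLL ξ
  exact ⟨⟨Z, W, hZW, mul_eq_one_comm.1 hZW⟩, hZ⟩

end Lattice

/-! ### Comparison of two torus actions -/

namespace TorusAction

variable {n : ℕ} {M : Type u} [TopologicalSpace M] [ChartedSpace (E (2 * n)) M]
  [IsManifold (𝓡 (2 * n)) ∞ M] {σ : Form n M} {Ψ Ψ' : TorusAction n M} {J F : M → E n}

/-- From `⟨ξ, Dh dF⟩ = ⟨(Dh)ᵀ ξ, dF⟩`, by non-degeneracy of `σ`. -/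
theorem IsMomentumMap.gen_eq (hJ : Ψ.IsMomentumMap σ J) (hF : Ψ'.IsMomentumMap σ F)
    {h : E n → E n} {m : M} (hh : DifferentiableAt ℝ h (F m))
    (hJF : J =ᶠ[𝓝 m] fun x => h (F x)) (ξ : E n) :
    Ψ.gen m ξ = Ψ'.gen m (ContinuousLinearMap.adjoint (fderiv ℝ h (F m)) ξ) := by
  have hin : ∀ x y : E n, ∑ i, x i * y i = inner ℝ x y := fun x y => by
    simp [PiLp.inner_apply, mul_comm]
  refine σ.eq_of_forall (x := m) fun v => ?_
  rw [hJ.bil_gen, hF.bil_gen, hin, hin, ContinuousLinearMap.adjoint_inner_left, mder_congr hJF,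
    mder_comp_apply hh.mdifferentiableAt (hF.mdifferentiableAt m), mder_eq_fderiv]

/-- In a chart of `P` the level sets of the actions are fibers of `J`, so `J = h(a)` with `h`
smooth, and `L = (Dh)ᵀ`. That `L` depends on `a` alone makes it constant along orbits of a `Ψ'`
translating the angles. -/
theorem IsMomentumMap.exists_gen_eq_gen (hJ : Ψ.IsMomentumMap σ J) {hR : IsOpen (range J)}
    {P : Set (ToricChart n M)} (hP : IsAtlasWithGlobalActions σ (ontoImage J hR) P)
    (hF : Ψ'.IsMomentumMap σ (globalActionMap P)) {c : ToricChart n M} (hc : c ∈ P) :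
    ∃ L : E n → E n →L[ℝ] E n, ContinuousOn L c.actionSet ∧
      ∀ m ∈ c.source, ∀ ξ, Ψ.gen m ξ = Ψ'.gen m (L (c.action m) ξ) := by
  set h : E n → E n := fun a => J (c.param (a, 0)) with hh
  have hs : ContDiffOn ℝ ∞ h c.actionSet := fun a ha => by
    have h1 : ContDiffAt ℝ ∞ (fun p => J (c.param p)) (a, 0) :=
      contMDiffAt_iff_contDiffAt.1 (hJ.1.contMDiffAt.comp _ (c.contMDiffAt_param ha))
    exact (ContDiffAt.comp (g := fun p => J (c.param p)) (f := fun a : E n => (a, (0 : E n))) a h1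
      (contDiffAt_id.prodMk contDiffAt_const)).contDiffWithinAt
  have hJh : ∀ x ∈ c.source, J x = h (c.action x) := fun x hx => by
    have ha := c.action_mem hx
    have h1 := ((hP.actionAngle c hc).fibers x hx (c.param (c.action x, 0))).2
      ⟨c.invFun_mem_source ha, c.action_invFun (q := (c.action x, torusExp 0)) ha⟩
    exact (congrArg Subtype.val h1).symm
  refine ⟨fun a => ContinuousLinearMap.adjoint (fderiv ℝ h a),
    ContinuousLinearMap.adjoint.continuous.comp_continuousOn
      (hs.continuousOn_fderiv_of_isOpen c.isOpen_actionSet (by simp)), fun m hm ξ => ?_⟩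
  rw [← hP.globalActionMap_eq hc hm]
  refine hJ.gen_eq hF ?_ ?_ ξ
  · rw [hP.globalActionMap_eq hc hm]
    exact (hs.contDiffAt (c.isOpen_actionSet.mem_nhds (c.action_mem hm))).differentiableAt (by simp)
  · filter_upwards [c.isOpen_source.mem_nhds hm] with x hx
    rw [hJh x hx, hP.globalActionMap_eq hc hx]

variable [T2Space M]

/-- If the infinitesimal actions are related along an orbit, then so are the actions. -/
theorem act_torusExp_eq {ξ η : E n} (hξ : SmoothField (Ψ.generator ξ)) {m : M}
    (h : ∀ β, Ψ.gen (Ψ'.act β m) ξ = Ψ'.gen (Ψ'.act β m) η) :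
    Ψ.act (torusExp ξ) m = Ψ'.act (torusExp η) m := by
  have h1 := Ψ'.isMIntegralCurve m η
  have h2 : IsMIntegralCurve (fun s : ℝ => Ψ'.act (torusExp (s • η)) m) (Ψ.generator ξ) := by
    rw [isMIntegralCurve_iff] at h1 ⊢
    refine fun s => ⟨(h1 s).1, (h1 s).2.trans ?_⟩
    exact (Ψ'.generator_eq _ η).trans ((h _).symm.trans (Ψ.generator_eq _ ξ).symm)
  have h3 := Ψ.act_smul_eq_of_isMIntegralCurve hξ h2 1
  simpa [Ψ'.act_one] using h3

theorem act_eq_of_isMomentumMap (hJ : Ψ.IsMomentumMap σ J) (hJ' : Ψ'.IsMomentumMap σ J)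
    (hσ : Ψ.IsFullyHamiltonian σ) : Ψ.act = Ψ'.act := by
  funext β m
  obtain ⟨t, rfl⟩ := torusExp_surjective β
  refine act_torusExp_eq (hσ.smoothField t) fun β => ?_
  rw [← generator_eq, ← generator_eq, (hJ.2 t).unique (hJ'.2 t)]

/-- Two free fully-Hamiltonian actions with the same orbits, the second of which translates the
angles of an atlas, differ by a unimodular automorphism of the torus. -/
theorem IsMomentumMap.exists_latticeMap (hJ : Ψ.IsMomentumMap σ J) (hΨ : Ψ.IsFree)
    (hσ : Ψ.IsFullyHamiltonian σ) {hR : IsOpen (range J)} {P : Set (ToricChart n M)}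
    (hP : IsAtlasWithGlobalActions σ (ontoImage J hR) P) (hΨ' : Ψ'.IsFree)
    (hF : Ψ'.IsMomentumMap σ (globalActionMap P)) (htr : ∀ c ∈ P, Ψ'.ActsByTranslation c) (m : M) :
    ∃ Z : GL (Fin n) ℤ, ∀ ξ, Ψ.gen m ξ = Ψ'.gen m (latticeMap Z.val ξ) ∧
      Ψ.act (torusExp ξ) m = Ψ'.act (torusExp (latticeMap Z.val ξ)) m := by
  obtain ⟨c, hc, hm⟩ := hP.cover m
  obtain ⟨L, -, hL⟩ := hJ.exists_gen_eq_gen hP hF hc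
  have hact : ∀ ξ, Ψ.act (torusExp ξ) m = Ψ'.act (torusExp (L (c.action m) ξ)) m := fun ξ =>
    act_torusExp_eq (hσ.smoothField ξ) fun β => by
      obtain ⟨h1, h2, -⟩ := htr c hc m hm β
      rw [hL _ h1, h2]
  have hinj : Function.Injective (L (c.action m)) := fun ξ η h =>
    hΨ.gen_injective hσ.smoothField m (by rw [hL m hm, hL m hm, h])
  -- At `m` the element `exp t` of `Ψ` acts as `exp (L t)` of `Ψ'`. Both actions being free, one is
  -- trivial exactly when the other is.
  obtain ⟨Z, hZ⟩ := exists_eq_latticeMap_of_injective (L (c.action m)).toLinearMap hinj fun t => by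
    constructor
    · intro ht
      refine hΨ _ m ((hact t).trans ?_)
      exact (congrArg (fun β => Ψ'.act β m) ht).trans (Ψ'.act_one m)
    · intro ht
      refine hΨ' _ m ((hact t).symm.trans ?_)
      rw [ht, Ψ.act_one]
  have hZ' : ∀ ξ, L (c.action m) ξ = latticeMap Z.val ξ := hZ
  exact ⟨Z, fun ξ => by rw [← hZ', ← hL m hm, hact]; exact ⟨rfl, rfl⟩⟩

theorem IsMomentumMap.exists_actsByTranslationVia (hJ : Ψ.IsMomentumMap σ J) (hΨ : Ψ.IsFree)
    (hσ : Ψ.IsFullyHamiltonian σ) {hR : IsOpen (range J)} {P : Set (ToricChart n M)}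
    (hP : IsAtlasWithGlobalActions σ (ontoImage J hR) P) (hΨ' : Ψ'.IsFree)
    (hσ' : Ψ'.IsFullyHamiltonian σ) (hF : Ψ'.IsMomentumMap σ (globalActionMap P))
    (htr : ∀ c ∈ P, Ψ'.ActsByTranslation c) :
    ∃ Z : M → GL (Fin n) ℤ, IsLocallyConstant Z ∧ ∀ c ∈ P, Ψ.ActsByTranslationVia Z c := by
  choose Z hZ using hJ.exists_latticeMap hΨ hσ hP hΨ' hF htr
  refine ⟨Z, (IsLocallyConstant.iff_eventually_eq Z).2 fun m => ?_, fun c hc m hm β => ?_⟩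
  · obtain ⟨c, hc, hm⟩ := hP.cover m
    obtain ⟨L, hLc, hL⟩ := hJ.exists_gen_eq_gen hP hF hc
    have hLZ : ∀ x ∈ c.source, ∀ i j,
        L (c.action x) (EuclideanSpace.single j 1) i = (Z x).val i j := fun x hx i j => by
      rw [← latticeMap_single]
      refine congrArg (fun y : E n => y i) (hΨ'.gen_injective hσ'.smoothField x ?_)
      rw [← hL x hx, (hZ x _).1]
    have hcont : ∀ i j, ContinuousAt
        (fun x => L (c.action x) (EuclideanSpace.single j 1) i) m := fun i j => by
      have h1 : ContinuousAt (fun x => L (c.action x)) m :=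
        ContinuousAt.comp (g := L)
          (hLc.continuousAt (c.isOpen_actionSet.mem_nhds (c.action_mem hm)))
          (c.contMDiffAt_action hm).continuousAt
      exact (EuclideanSpace.proj i : E n →L[ℝ] ℝ).continuous.continuousAt.comp
        (h1.clm_apply continuousAt_const)
    -- These entries are integers and continuous in `x`; integers at distance less than `1` are
    -- equal.
    have hev : ∀ᶠ x in 𝓝 m, ∀ i j, |L (c.action x) (EuclideanSpace.single j 1) i
        - L (c.action m) (EuclideanSpace.single j 1) i| < 1 := by
      refine Filter.eventually_all.2 fun i => Filter.eventually_all.2 fun j => ?_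
      exact Metric.tendsto_nhds.1 (hcont i j) 1 one_pos
    filter_upwards [hev, c.isOpen_source.mem_nhds hm] with x hx hxc
    ext i j
    have h1 := hx i j
    rw [hLZ x hxc, hLZ m hm, ← Int.cast_sub, ← Int.cast_abs] at h1
    have h2 : |(Z x).val i j - (Z m).val i j| < 1 := by exact_mod_cast h1
    exact sub_eq_zero.1 (Int.abs_lt_one_iff.1 h2)
  · obtain ⟨t, rfl⟩ := torusExp_surjective β
    obtain ⟨h1, h2, h3⟩ := htr c hc m hm (torusExp (latticeMap (Z m).val t))
    rw [(hZ m t).2]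
    refine ⟨h1, h2, fun i => ?_⟩
    rw [h3, Pi.mul_apply, torusExp_latticeMap]

end TorusAction

end AlmostSymplectic

theorem mainTheorem5 {n : ℕ} {M : Type u} [TopologicalSpace M] [T2Space M]
    [SecondCountableTopology M] [ChartedSpace (AlmostSymplectic.E (2 * n)) M]
    [IsManifold (𝓡 (2 * n)) ∞ M] (σ : AlmostSymplectic.Form n M) :
    (∀ (k : ℕ) (B : Type v) [TopologicalSpace B] [T2Space B] [SecondCountableTopology B]
        [ChartedSpace (AlmostSymplectic.E k) B] [IsManifold (𝓡 k) ∞ B] (π : M → B),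
        AlmostSymplectic.IsFullyLagrangianToricFibration (k := k) σ π →
        ∀ P : Set (AlmostSymplectic.ToricChart n M),
          AlmostSymplectic.IsAtlasWithGlobalActions σ π P →
          ∃ Ψ : AlmostSymplectic.TorusAction n M,
            Ψ.IsFree ∧ Ψ.IsFullyHamiltonian σ ∧
            Ψ.IsMomentumMap σ (AlmostSymplectic.globalActionMap P) ∧
            ∀ c ∈ P, Ψ.ActsByTranslation c) ∧
    (∀ (Ψ : AlmostSymplectic.TorusAction n M) (J : M → AlmostSymplectic.E n),
        Ψ.IsFree → Ψ.IsFullyHamiltonian σ → Ψ.IsMomentumMap σ J →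
        (∀ a : AlmostSymplectic.E n, IsPreconnected (J ⁻¹' {a})) →
        ∃ hJ : IsOpen (range J),
          AlmostSymplectic.IsFullyLagrangianToricFibration (k := n) σ (AlmostSymplectic.ontoImage J hJ) ∧
          AlmostSymplectic.HasGlobalActions σ (AlmostSymplectic.ontoImage J hJ) ∧
          (∃ P : Set (AlmostSymplectic.ToricChart n M),
            AlmostSymplectic.IsAtlasWithGlobalActions σ (AlmostSymplectic.ontoImage J hJ) P ∧
            AlmostSymplectic.globalActionMap P = J) ∧
          ∀ P : Set (AlmostSymplectic.ToricChart n M),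
            AlmostSymplectic.IsAtlasWithGlobalActions σ (AlmostSymplectic.ontoImage J hJ) P →
            (∃ Z : M → GL (Fin n) ℤ, IsLocallyConstant Z ∧
              ∀ c ∈ P, Ψ.ActsByTranslationVia Z c) ∧
            (AlmostSymplectic.globalActionMap P = J → ∀ c ∈ P, Ψ.ActsByTranslation c)) := by
  refine ⟨fun k B _ _ _ _ _ π hπ P hP => hP.exists_action hπ, fun Ψ J hΨ hσ hJ hconn => ?_⟩
  have hR := hJ.isOpen_range hΨ hσ
  have hfib := hJ.isFullyLagrangianToricFibration hΨ hσ hconn hR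
  obtain ⟨P₀, hP₀, hJP₀⟩ := hJ.exists_atlas hΨ hσ hconn hR
  refine ⟨hR, hfib, ⟨P₀, hP₀⟩, ⟨P₀, hP₀, hJP₀⟩, fun P hP => ?_⟩
  -- Part (i), applied to the fibration just obtained and the given atlas, supplies the reference
  -- action. When its momentum map is `J`, it coincides with `Ψ`.
  obtain ⟨Ψ', hΨ', hσ', hF, htr⟩ := hP.exists_action hfib
  refine ⟨hJ.exists_actsByTranslationVia hΨ hσ hP hΨ' hσ' hF htr, fun h c hc m hm β => ?_⟩
  rw [AlmostSymplectic.TorusAction.act_eq_of_isMomentumMap hJ (h ▸ hF) hσ]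
  exact htr c hc m hm β
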